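/- Let $B$ be a real $C^*$-algebra, that is, a norm-closed real $*$-subalgebra of $B(L)$ for some real Hilbert space $L$ (equivalently, up to isometric $*$-isomorphism, a real Banach $*$-algebra that has an isometric $*$-representation on a real Hilbert space); $B$ need not be unital. Identify $M_n(B(L))$ with $B(L^{n})$, so that matrices over subspaces of $B(L)$ have a norm and an adjoint, and may be positive. Let $A\subseteq B$ be a real linear subspace which is either (i) a unital subspace of $B$, i.e. $B$ has an identity $1_B$ and $1_B\in A$; or (ii) an approximately unital Jordan subalgebra of $B$, i.e. $A$ is norm closed, closed under the Jordan product $a\circ b=\frac12(ab+ba)$, and there is a net $(e_t)$ of elements of $A$ with $\|e_t\|\le 1$ and $e_t\circ a\to a$ for every $a\in A$. Let $H$ be a real Hilbert space and let $T:A\to B(H)$ be a real completely positive linear map: for all $n$ and all $x\in M_n(A)$ with $x+x^*\ge 0$, the matrix $T_n(x)=[T(x_{ij})]\in M_n(B(H))=B(H^{n})$ satisfies $T_n(x)+T_n(x)^*\ge 0$. Then there are a linear map $\tilde T:B\to B(H)$ which extends $T$ and is completely positive (each $\tilde T_n$ takes positive matrices to positive matrices), a real Hilbert space $K$, a $*$-representation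 $\pi:B\to B(K)$, and a bounded operator $V:H\to K$ such that $$\tilde T(b)=V^*\pi(b)V\qquad (b\in B),$$ and $$\|T\|=\|T\|_{\rm cb}=\|\tilde T\|_{\rm cb}=\|V\|^2<\infty ,$$ where $\|T\|_{\rm cb}=\sup_n\|T_n\|$. If moreover $A$ has an identity (an element $e\in A$ with $e\circ a=a$ for all $a\in A$; in case (i) this is $1_B$), then these numbers also equal $\|T(e)\|$. -/

import Mathlib

open Filter Topology
open scoped ENNReal

universe u v

noncomputable section

/-- The operator on the Hilbert space `H^n` given by an `n × n` matrix of operators on `H`: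
this is the identification `M_n(B(H)) = B(H^n)`. -/
def matOp {H : Type*} [NormedAddCommGroup H] [InnerProductSpace ℝ H] {n : ℕ}
    (x : Matrix (Fin n) (Fin n) (H →L[ℝ] H)) :
    PiLp 2 (fun _ : Fin n => H) →L[ℝ] PiLp 2 (fun _ : Fin n => H) :=
  (PiLp.continuousLinearEquiv 2 ℝ (fun _ : Fin n => H)).symm.toContinuousLinearMap ∘L
    ContinuousLinearMap.pi
      (fun i => ∑ j, x i j ∘L PiLp.proj (𝕜 := ℝ) 2 (fun _ : Fin n => H) j)

theorem matOp_apply {H : Type*} [NormedAddCommGroup H] [InnerProductSpace ℝ H] {n : ℕ}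
    (x : Matrix (Fin n) (Fin n) (H →L[ℝ] H)) (v : PiLp 2 (fun _ : Fin n => H)) (i : Fin n) :
    matOp x v i = ∑ j, x i j (v j) := by
  simp [matOp]

/-- An operator `a` on a real Hilbert space is real positive if `a + a* ≥ 0`. -/
def IsRealPositive {H : Type*} [NormedAddCommGroup H] [InnerProductSpace ℝ H] [CompleteSpace H]
    (a : H →L[ℝ] H) : Prop :=
  (a + star a).IsPositive

section Maps

variable {L : Type*} [NormedAddCommGroup L] [InnerProductSpace ℝ L] [CompleteSpace L]
variable {H : Type*} [NormedAddCommGroup H] [InnerProductSpace ℝ H] [CompleteSpace H]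

/-- A matrix over a space `X` of operators, seen as an operator on `L^n`. -/
def matSub {X : Submodule ℝ (L →L[ℝ] L)} {n : ℕ} (x : Matrix (Fin n) (Fin n) X) :
    PiLp 2 (fun _ : Fin n => L) →L[ℝ] PiLp 2 (fun _ : Fin n => L) :=
  matOp (x.map (fun a => (a : L →L[ℝ] L)))

/-- `T_n(x)`, the entrywise image of the matrix `x`, seen as an operator on `H^n`. -/
def matAmp {X : Submodule ℝ (L →L[ℝ] L)} (T : X →ₗ[ℝ] (H →L[ℝ] H)) {n : ℕ}
    (x : Matrix (Fin n) (Fin n) X) :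
    PiLp 2 (fun _ : Fin n => H) →L[ℝ] PiLp 2 (fun _ : Fin n => H) :=
  matOp (x.map T)

/-- `T` is real completely positive: every `T_n` takes real positive matrices to real positive
matrices. -/
def IsRCP {X : Submodule ℝ (L →L[ℝ] L)} (T : X →ₗ[ℝ] (H →L[ℝ] H)) : Prop :=
  ∀ (n : ℕ) (x : Matrix (Fin n) (Fin n) X), IsRealPositive (matSub x) → IsRealPositive (matAmp T x)

/-- `T` is completely positive: every `T_n` takes positive matrices to positive matrices. -/
def IsCP {X : Submodule ℝ (L →L[ℝ] L)} (T : X →ₗ[ℝ] (H →L[ℝ] H)) : Prop :=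
  ∀ (n : ℕ) (x : Matrix (Fin n) (Fin n) X), (matSub x).IsPositive → (matAmp T x).IsPositive

/-- The norm `‖T‖` of a linear map, with value `∞` if `T` is unbounded. -/
def mapNorm {X : Submodule ℝ (L →L[ℝ] L)} (T : X →ₗ[ℝ] (H →L[ℝ] H)) : ℝ≥0∞ :=
  ⨆ (x : X) (_ : ‖x‖ ≤ 1), ‖T x‖ₑ

/-- The completely bounded norm `‖T‖_cb = sup_n ‖T_n‖`, with value `∞` if `T` is not completely
bounded. -/
def mapCbNorm {X : Submodule ℝ (L →L[ℝ] L)} (T : X →ₗ[ℝ] (H →L[ℝ] H)) : ℝ≥0∞ :=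
  ⨆ (n : ℕ) (x : Matrix (Fin n) (Fin n) X) (_ : ‖matSub x‖ ≤ 1), ‖matAmp T x‖ₑ

/-- The Jordan product `a ∘ b = (ab + ba) / 2`. -/
def jordanProd (a b : L →L[ℝ] L) : L →L[ℝ] L := (2⁻¹ : ℝ) • (a * b + b * a)

/-- `A` is a unital subspace of `B`: it contains an identity element of `B` (which need not be
the identity operator of the Hilbert space). -/
def IsUnitalSubspace (A : Submodule ℝ (L →L[ℝ] L))
    (B : NonUnitalStarSubalgebra ℝ (L →L[ℝ] L)) : Prop :=
  A ≤ B.toSubmodule ∧ ∃ e ∈ A, ∀ b ∈ B, e * b = b ∧ b * e = b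

/-- `A` is an approximately unital (norm-closed) Jordan subalgebra of `B`: it is closed under the
Jordan product and there is a net of contractions `e_t` in `A` (given here by a filter) with
`e_t ∘ a → a` for all `a ∈ A`. -/
def IsApproxUnitalJordanSubalgebra (A : Submodule ℝ (L →L[ℝ] L))
    (B : NonUnitalStarSubalgebra ℝ (L →L[ℝ] L)) : Prop :=
  A ≤ B.toSubmodule ∧ IsClosed (A : Set (L →L[ℝ] L)) ∧
    (∀ a ∈ A, ∀ b ∈ A, jordanProd a b ∈ A) ∧
    ∃ l : Filter (L →L[ℝ] L), l.NeBot ∧ (∀ᶠ e in l, e ∈ A ∧ ‖e‖ ≤ 1) ∧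
      ∀ a ∈ A, Tendsto (fun e => jordanProd e a) l (𝓝 a)

end Maps

end

/-! The plan is to extend $T$ to a real completely positive map $\Phi$ on all of $B(L)$ with
$\langle\Phi(1)h,h\rangle\le\|T\|\,\|h\|^2$, dilate $\Phi$ by Stinespring's construction, and
restrict to $B$. Working in $B(L)$ supplies an identity operator whether or not $B$ has one. Since
$\|V\|^2=\sup_{\|h\|\le1}\langle\Phi(1)h,h\rangle$, all the norm equalities come from the circle
$\|V\|^2\le\|T\|\le\|T\|_{cb}\le\|\tilde T\|_{cb}\le\|V\|^2$.

In the Jordan case the difficulty is that $A$ need contain neither an identity nor any selfadjoint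
approximate unit. The Jordan approximate unit is two-sided for the ordinary product, and suitable
averages of its members have skew part tending to $0$ in norm
(`hasAlmostSelfAdjointUnits_of_tendsto`). With such an $f$, a matrix $y$ over $A$ with
$y\ge-\varepsilon$ satisfies $y\approx f^*yf\ge-\varepsilon f^*f\approx-\varepsilon f^2$
(inequalities between quadratic forms). Iterating, $y$ becomes real positive after adding to its
diagonal an element of $A$ of norm at most $2\varepsilon$ (`HasAbsorption`). This replaces the
identity both in proving $T$ bounded and in showing that $T$ respects positivity of $a+m\otimes1$,
with $m$ a scalar matrix (`IsRCP.quadForm_add_scalar_nonneg`). In the unital case the identity is a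
projection and does both jobs directly.

A bounded-operator-valued map on $B(L)$ amounts to a functional on $H\otimes H\otimes B(L)$, written
as finitely supported matrices in a Hamel basis of $H$. The M. Riesz extension theorem is applied
once, on these matrices times $\mathbb R$; the extra coordinate of `dominationCone` records the
bound on $\Phi(1)$. Over $\mathbb R$ a quadratic form does not see the skew part of an operator, so
compatibility of $\Phi$ with adjoints is obtained separately, by testing on skew matrices
(`IsRCP.inner_map_star`). -/

section ApproximateIdentity

/-! ### Approximate units: from the Jordan product to almost selfadjoint averages. -/

variable {L : Type*} [NormedAddCommGroup L] [InnerProductSpace ℝ L]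

/-- Rests on $ea^2=e\circ a^2+(e\circ a)a-a(e\circ a)$ and its mirror image. -/
theorem tendsto_mul_sq {l : Filter (L →L[ℝ] L)} {a : L →L[ℝ] L}
    (h1 : Tendsto (fun e => jordanProd e a) l (𝓝 a))
    (h2 : Tendsto (fun e => jordanProd e (a * a)) l (𝓝 (a * a))) :
    Tendsto (fun e => e * (a * a)) l (𝓝 (a * a)) ∧
      Tendsto (fun e => a * a * e) l (𝓝 (a * a)) := by
  constructor
  · have := (h2.add (h1.mul_const a)).sub (h1.const_mul a)
    rw [add_sub_cancel_right] at this
    refine this.congr fun e => ?_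
    simp only [jordanProd, smul_mul_assoc, mul_smul_comm, ← smul_add, ← smul_sub]
    rw [inv_smul_eq_iff₀ two_ne_zero, two_smul]
    noncomm_ring
  · have := (h2.sub (h1.mul_const a)).add (h1.const_mul a)
    rw [sub_add_cancel] at this
    refine this.congr fun e => ?_
    simp only [jordanProd, smul_mul_assoc, mul_smul_comm, ← smul_add, ← smul_sub]
    rw [inv_smul_eq_iff₀ two_ne_zero, two_smul]
    noncomm_ring

theorem jordanProd_self (a : L →L[ℝ] L) : jordanProd a a = a * a := by
  rw [jordanProd, inv_smul_eq_iff₀ two_ne_zero, two_smul]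

theorem jordanProd_eq_squares (a b : L →L[ℝ] L) :
    jordanProd a b = (2⁻¹ : ℝ) • ((a + b) * (a + b) - a * a - b * b) := by
  rw [jordanProd]; congr 1; noncomm_ring

theorem jordanProd_comm (a b : L →L[ℝ] L) : jordanProd a b = jordanProd b a := by
  rw [jordanProd, jordanProd, add_comm]

/-- Squares are handled by `tendsto_mul_sq`, hence by polarization all Jordan products. These are
dense in $A$, because $s\circ a\to a$ along the net itself, and the bound $\|e\|\le1$ carries the
limit over to the closure. -/
theorem tendsto_mul_of_tendsto_jordanProd {A : Submodule ℝ (L →L[ℝ] L)}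
    (hJ : ∀ a ∈ A, ∀ b ∈ A, jordanProd a b ∈ A) {l : Filter (L →L[ℝ] L)} [l.NeBot]
    (hl : ∀ᶠ e in l, e ∈ A ∧ ‖e‖ ≤ 1)
    (h : ∀ a ∈ A, Tendsto (fun e => jordanProd e a) l (𝓝 a)) {a : L →L[ℝ] L} (ha : a ∈ A) :
    Tendsto (fun e => e * a) l (𝓝 a) ∧ Tendsto (fun e => a * e) l (𝓝 a) := by
  have hsq : ∀ b ∈ A, Tendsto (fun e => e * (b * b)) l (𝓝 (b * b)) ∧
      Tendsto (fun e => b * b * e) l (𝓝 (b * b)) := fun b hb =>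
    tendsto_mul_sq (h b hb) (h _ (jordanProd_self b ▸ hJ b hb b hb))
  have hprod : ∀ b ∈ A, ∀ c ∈ A, Tendsto (fun e => e * jordanProd b c) l (𝓝 (jordanProd b c)) ∧
      Tendsto (fun e => jordanProd b c * e) l (𝓝 (jordanProd b c)) := by
    intro b hb c hc
    have h1 := hsq _ (A.add_mem hb hc)
    rw [jordanProd_eq_squares]
    constructor
    · refine ((((h1.1.sub (hsq b hb).1).sub (hsq c hc).1)).const_smul (2⁻¹ : ℝ)).congr fun e => ?_
      rw [mul_smul_comm, mul_sub, mul_sub]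
    · refine ((((h1.2.sub (hsq b hb).2).sub (hsq c hc).2)).const_smul (2⁻¹ : ℝ)).congr fun e => ?_
      rw [smul_mul_assoc, sub_mul, sub_mul]
  have approx : ∀ ε > 0, ∃ s ∈ A, ‖jordanProd s a - a‖ < ε := by
    intro ε hε
    have h1 := (h a ha).eventually (Metric.ball_mem_nhds a hε)
    obtain ⟨s, hs, hs'⟩ := (hl.and h1).exists
    exact ⟨s, hs.1, by simpa [dist_eq_norm] using hs'⟩
  constructor
  · rw [Metric.tendsto_nhds]
    intro ε hε
    obtain ⟨s, hs, hsa⟩ := approx (ε / 3) (by positivity)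
    filter_upwards [hl, (hprod s hs a ha).1.eventually (Metric.ball_mem_nhds _ (ε := ε / 3)
      (by positivity))] with e he he'
    rw [dist_eq_norm] at he' ⊢
    have e1 : e * a - a = (e * jordanProd s a - jordanProd s a) + (jordanProd s a - a)
      - e * (jordanProd s a - a) := by noncomm_ring
    have e2 : ‖e * (jordanProd s a - a)‖ ≤ ‖jordanProd s a - a‖ :=
      (norm_mul_le _ _).trans (mul_le_of_le_one_left (norm_nonneg _) he.2)
    rw [e1]
    have := norm_sub_le (e * jordanProd s a - jordanProd s a + (jordanProd s a - a))
      (e * (jordanProd s a - a))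
    have := norm_add_le (e * jordanProd s a - jordanProd s a) (jordanProd s a - a)
    linarith
  · rw [Metric.tendsto_nhds]
    intro ε hε
    obtain ⟨s, hs, hsa⟩ := approx (ε / 3) (by positivity)
    filter_upwards [hl, (hprod s hs a ha).2.eventually (Metric.ball_mem_nhds _ (ε := ε / 3)
      (by positivity))] with e he he'
    rw [dist_eq_norm] at he' ⊢
    have e1 : a * e - a = (jordanProd s a * e - jordanProd s a) + (jordanProd s a - a)
      - (jordanProd s a - a) * e := by noncomm_ring
    have e2 : ‖(jordanProd s a - a) * e‖ ≤ ‖jordanProd s a - a‖ :=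
      (norm_mul_le _ _).trans (mul_le_of_le_one_right (norm_nonneg _) he.2)
    rw [e1]
    have := norm_sub_le (jordanProd s a * e - jordanProd s a + (jordanProd s a - a))
      ((jordanProd s a - a) * e)
    have := norm_add_le (jordanProd s a * e - jordanProd s a) (jordanProd s a - a)
    linarith

variable [CompleteSpace L]

theorem norm_star_operator (u : L →L[ℝ] L) : ‖star u‖ = ‖u‖ :=
  LinearIsometryEquiv.norm_map ContinuousLinearMap.adjoint u

/-- Expand $\|u^*av-av\|^2$ and use $\|u^*av\|\le\|av\|$: what remains is at most $-2\langle
av,(ua-a)v\rangle$. -/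
theorem norm_star_mul_sub_sq_le {u : L →L[ℝ] L} (hu : ‖u‖ ≤ 1) (a : L →L[ℝ] L) :
    ‖star u * a - a‖ ^ 2 ≤ 2 * ‖a‖ * ‖u * a - a‖ := by
  have key : ‖star u * a - a‖ ≤ √(2 * ‖a‖ * ‖u * a - a‖) := by
    refine ContinuousLinearMap.opNorm_le_bound _ (Real.sqrt_nonneg _) fun v => ?_
    have h1 : ‖(star u * a - a) v‖ ^ 2 ≤ (2 * ‖a‖ * ‖u * a - a‖) * ‖v‖ ^ 2 := by
      have e1 : (star u * a - a) v = star u (a v) - a v := rfl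
      rw [e1, norm_sub_sq_real]
      have e2 : inner ℝ (star u (a v)) (a v) = inner ℝ (a v) (u (a v)) := by
        rw [ContinuousLinearMap.star_eq_adjoint, ContinuousLinearMap.adjoint_inner_left]
      have e3 : ‖star u (a v)‖ ≤ ‖a v‖ := by
        calc ‖star u (a v)‖ ≤ ‖star u‖ * ‖a v‖ := ContinuousLinearMap.le_opNorm _ _
          _ ≤ 1 * ‖a v‖ := by rw [norm_star_operator]; gcongr
          _ = ‖a v‖ := one_mul _
      have e4 : ‖star u (a v)‖ ^ 2 ≤ ‖a v‖ ^ 2 := by gcongr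
      have e5 : -inner ℝ (a v) ((u * a - a) v) ≤ (‖a‖ * ‖v‖) * (‖u * a - a‖ * ‖v‖) := by
        calc -inner ℝ (a v) ((u * a - a) v) ≤ |inner ℝ (a v) ((u * a - a) v)| := neg_le_abs _
          _ ≤ ‖a v‖ * ‖(u * a - a) v‖ := abs_real_inner_le_norm _ _
          _ ≤ _ := by gcongr <;> exact ContinuousLinearMap.le_opNorm _ _
      have e6 : inner ℝ (a v) ((u * a - a) v) = inner ℝ (a v) (u (a v)) - ‖a v‖ ^ 2 := by
        rw [← real_inner_self_eq_norm_sq, ← inner_sub_right]; rfl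
      rw [e2]
      nlinarith
    calc ‖(star u * a - a) v‖ = √(‖(star u * a - a) v‖ ^ 2) := (Real.sqrt_sq (norm_nonneg _)).symm
      _ ≤ √((2 * ‖a‖ * ‖u * a - a‖) * ‖v‖ ^ 2) := Real.sqrt_le_sqrt h1
      _ = _ := by rw [Real.sqrt_mul (by positivity), Real.sqrt_sq (norm_nonneg _)]
  calc ‖star u * a - a‖ ^ 2 ≤ √(2 * ‖a‖ * ‖u * a - a‖) ^ 2 := by gcongr
    _ = _ := Real.sq_sqrt (by positivity)

theorem tendsto_star_mul {l : Filter (L →L[ℝ] L)} (hl : ∀ᶠ e in l, ‖e‖ ≤ 1) {a : L →L[ℝ] L}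
    (h : Tendsto (fun e => e * a) l (𝓝 a)) : Tendsto (fun e => star e * a) l (𝓝 a) := by
  rw [tendsto_iff_norm_sub_tendsto_zero] at h ⊢
  have h2 : Tendsto (fun e : L →L[ℝ] L => √(2 * ‖a‖ * ‖e * a - a‖)) l (𝓝 0) := by
    have := (h.const_mul (2 * ‖a‖)).sqrt
    simpa using this
  refine squeeze_zero' (Eventually.of_forall fun _ => norm_nonneg _) ?_ h2
  filter_upwards [hl] with e he
  exact Real.le_sqrt_of_sq_le (norm_star_mul_sub_sq_le he a)

theorem tendsto_mul_star {l : Filter (L →L[ℝ] L)} (hl : ∀ᶠ e in l, ‖e‖ ≤ 1) {a : L →L[ℝ] L}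
    (h : Tendsto (fun e => a * e) l (𝓝 a)) : Tendsto (fun e => a * star e) l (𝓝 a) := by
  have h1 : Tendsto (fun e => star e * star a) l (𝓝 (star a)) := by
    simpa [Function.comp_def] using (continuous_star.tendsto a).comp h
  have h2 : Tendsto (fun e => e * star a) l (𝓝 (star a)) := by
    have := tendsto_star_mul (l := l.map star) (by simpa [norm_star_operator] using hl) (a := star a)
      (by rw [tendsto_map'_iff]; exact h1)
    rw [tendsto_map'_iff] at this
    simpa [Function.comp_def] using this
  have := (continuous_star.tendsto (star a)).comp h2
  simpa [Function.comp_def] using this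

/-- Late members of the net have skew part almost orthogonal to that of a fixed $g$: the four terms
of the product tend to $g^*,-g^*,-g,g$. -/
theorem tendsto_skew_mul_skew {l : Filter (L →L[ℝ] L)} (hl : ∀ᶠ e in l, ‖e‖ ≤ 1)
    {g : L →L[ℝ] L} (h1 : Tendsto (fun e => e * g) l (𝓝 g))
    (h2 : Tendsto (fun e => g * e) l (𝓝 g)) :
    Tendsto (fun e => star (g - star g) * (e - star e)) l (𝓝 0) := by
  have a1 : Tendsto (fun e => star g * e) l (𝓝 (star g)) := by
    simpa [Function.comp_def] using (continuous_star.tendsto g).comp (tendsto_star_mul hl h1)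
  have a2 : Tendsto (fun e => star g * star e) l (𝓝 (star g)) := by
    simpa [Function.comp_def] using (continuous_star.tendsto g).comp h1
  have := ((a1.sub a2).sub h2).add (tendsto_mul_star hl h2)
  rw [sub_self, zero_sub, neg_add_cancel] at this
  refine this.congr fun e => ?_
  rw [star_sub, star_star]
  noncomm_ring

theorem norm_add_sq_le_of_star_mul {s d : L →L[ℝ] L} :
    ‖s + d‖ ^ 2 ≤ ‖s‖ ^ 2 + 2 * ‖star s * d‖ + ‖d‖ ^ 2 := by
  have e1 : star (s + d) * (s + d) = star s * s + star s * d + star (star s * d) + star d * d := by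
    rw [star_mul, star_star, star_add]; noncomm_ring
  rw [pow_two, ← CStarRing.norm_star_mul_self, e1, pow_two ‖s‖, pow_two ‖d‖,
    ← CStarRing.norm_star_mul_self, ← CStarRing.norm_star_mul_self (x := d)]
  have h1 := norm_add₃_le (a := star s * s) (b := star s * d) (c := star (star s * d))
  have h2 := norm_add_le (star s * s + star s * d + star (star s * d)) (star d * d)
  rw [norm_star_operator] at h1
  linarith

/-- A real subspace `A` of operators contains approximate units which are almost selfadjoint, and
whose squares belong to `A`. -/
def HasAlmostSelfAdjointUnits (A : Submodule ℝ (L →L[ℝ] L)) : Prop :=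
  ∀ (F : Finset (L →L[ℝ] L)), (∀ a ∈ F, a ∈ A) → ∀ δ > 0,
    ∃ f ∈ A, f * f ∈ A ∧ ‖f‖ ≤ 1 ∧ ‖f - star f‖ ≤ δ ∧ ∀ a ∈ F, ‖f * a * f - a‖ ≤ δ

/-- A Pythagorean estimate: each new summand is taken so late that its skew part is almost
orthogonal to the skew part accumulated so far. Hence the skew part of the sum grows like $\sqrt N$
and not like $N$. -/
theorem exists_sum_almost_selfAdjoint {A : Submodule ℝ (L →L[ℝ] L)}
    {l : Filter (L →L[ℝ] L)} [l.NeBot] (hl : ∀ᶠ e in l, e ∈ A ∧ ‖e‖ ≤ 1)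
    (h1 : ∀ a ∈ A, Tendsto (fun e => e * a) l (𝓝 a))
    (h2 : ∀ a ∈ A, Tendsto (fun e => a * e) l (𝓝 a))
    (F : Finset (L →L[ℝ] L)) (hF : ∀ a ∈ F, a ∈ A) {δ : ℝ} (hδ : 0 < δ) (N : ℕ) :
    ∃ g ∈ A, ‖g‖ ≤ N ∧ ‖g - star g‖ ^ 2 ≤ 5 * N ∧
      ∀ a ∈ F, ‖g * a - (N : ℝ) • a‖ ≤ N * δ ∧ ‖a * g - (N : ℝ) • a‖ ≤ N * δ := by
  induction N with
  | zero => exact ⟨0, A.zero_mem, by simp, by simp, by simp⟩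
  | succ N ih =>
    obtain ⟨g, hg, hgN, hgs, hga⟩ := ih
    have ev1 : ∀ᶠ e in l, ∀ a ∈ F, ‖e * a - a‖ ≤ δ ∧ ‖a * e - a‖ ≤ δ := by
      rw [Filter.eventually_all_finset]
      intro a ha
      filter_upwards [(h1 a (hF a ha)).eventually (Metric.closedBall_mem_nhds a hδ),
        (h2 a (hF a ha)).eventually (Metric.closedBall_mem_nhds a hδ)] with e x y
      exact ⟨by simpa [dist_eq_norm] using x, by simpa [dist_eq_norm] using y⟩
    -- The $1/2$ makes the cross term at most $1$; with $\|e-e^*\|^2\le4$ the increment is $5$.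
    have ev2 := (tendsto_skew_mul_skew (hl.mono fun _ h => h.2) (h1 g hg) (h2 g hg)).eventually
      (Metric.closedBall_mem_nhds 0 (ε := 1 / 2) (by norm_num))
    obtain ⟨e, ⟨heA, he⟩, hea, hed⟩ := (hl.and (ev1.and ev2)).exists
    rw [dist_zero_right] at hed
    refine ⟨g + e, A.add_mem hg heA, ?_, ?_, fun a ha => ⟨?_, ?_⟩⟩
    · push_cast
      exact (norm_add_le _ _).trans (by linarith)
    · have e1 : g + e - star (g + e) = (g - star g) + (e - star e) := by rw [star_add]; abel
      have e2 : ‖e - star e‖ ≤ 2 := (norm_sub_le _ _).trans (by rw [norm_star_operator]; linarith)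
      have e3 : ‖e - star e‖ ^ 2 ≤ 2 ^ 2 := by gcongr
      rw [e1]
      have := norm_add_sq_le_of_star_mul (s := g - star g) (d := e - star e)
      push_cast
      linarith
    · have e1 : (g + e) * a - ((N + 1 : ℕ) : ℝ) • a = (g * a - (N : ℝ) • a) + (e * a - a) := by
        push_cast; rw [add_mul, add_smul, one_smul]; abel
      rw [e1]; push_cast
      have := norm_add_le (g * a - (N : ℝ) • a) (e * a - a)
      linarith [hga a ha, hea a ha]
    · have e1 : a * (g + e) - ((N + 1 : ℕ) : ℝ) • a = (a * g - (N : ℝ) • a) + (a * e - a) := by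
        push_cast; rw [mul_add, add_smul, one_smul]; abel
      rw [e1]; push_cast
      have := norm_add_le (a * g - (N : ℝ) • a) (a * e - a)
      linarith [hga a ha, hea a ha]

theorem hasAlmostSelfAdjointUnits_of_tendsto {A : Submodule ℝ (L →L[ℝ] L)}
    (hJ : ∀ a ∈ A, ∀ b ∈ A, jordanProd a b ∈ A)
    {l : Filter (L →L[ℝ] L)} [l.NeBot] (hl : ∀ᶠ e in l, e ∈ A ∧ ‖e‖ ≤ 1)
    (h1 : ∀ a ∈ A, Tendsto (fun e => e * a) l (𝓝 a))
    (h2 : ∀ a ∈ A, Tendsto (fun e => a * e) l (𝓝 a)) : HasAlmostSelfAdjointUnits A := by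
  intro F hF δ hδ
  -- The average $g/N$ has skew part of squared norm at most $5/N<\delta^2$.
  obtain ⟨N, hN⟩ := exists_nat_gt (5 / δ ^ 2)
  have hN0 : (0 : ℝ) < N := lt_trans (by positivity) hN
  obtain ⟨g, hg, hgN, hgs, hga⟩ := exists_sum_almost_selfAdjoint hl h1 h2 F hF (half_pos hδ) N
  have hsc : ∀ x : L →L[ℝ] L, ∀ r : ℝ, ‖x‖ ≤ N * r → ‖(N : ℝ)⁻¹ • x‖ ≤ r := by
    intro x r hx
    rw [norm_smul, norm_inv, Real.norm_natCast, inv_mul_le_iff₀ hN0]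
    exact hx
  have hf1 : ‖(N : ℝ)⁻¹ • g‖ ≤ 1 := hsc g 1 (by simpa using hgN)
  have hfA : (N : ℝ)⁻¹ • g ∈ A := A.smul_mem _ hg
  refine ⟨(N : ℝ)⁻¹ • g, hfA, jordanProd_self ((N : ℝ)⁻¹ • g) ▸ hJ _ hfA _ hfA, hf1, ?_,
    fun a ha => ?_⟩
  · rw [star_smul, star_trivial, ← smul_sub]
    refine hsc _ _ (abs_le_of_sq_le_sq' ?_ (by positivity)).2
    rw [div_lt_iff₀ (by positivity)] at hN
    nlinarith
  · have e1 : ∀ f : L →L[ℝ] L, f * a * f - a = f * (a * f - a) + (f * a - a) := by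
      intro f; noncomm_ring
    have e2 : ((N : ℝ)⁻¹ • g) * a - a = (N : ℝ)⁻¹ • (g * a - (N : ℝ) • a) := by
      rw [smul_sub, smul_smul, inv_mul_cancel₀ hN0.ne', one_smul, smul_mul_assoc]
    have e3 : a * ((N : ℝ)⁻¹ • g) - a = (N : ℝ)⁻¹ • (a * g - (N : ℝ) • a) := by
      rw [smul_sub, smul_smul, inv_mul_cancel₀ hN0.ne', one_smul, mul_smul_comm]
    rw [e1]
    have n2 := hsc _ _ (hga a ha).1
    have n3 := hsc _ _ (hga a ha).2
    rw [← e2] at n2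
    rw [← e3] at n3
    have n4 := (norm_mul_le ((N : ℝ)⁻¹ • g) (a * ((N : ℝ)⁻¹ • g) - a)).trans
      (mul_le_of_le_one_left (norm_nonneg _) hf1)
    have := norm_add_le (((N : ℝ)⁻¹ • g) * (a * ((N : ℝ)⁻¹ • g) - a)) (((N : ℝ)⁻¹ • g) * a - a)
    linarith

end ApproximateIdentity

/-! ### Real positivity through quadratic forms, and absorption of small negative parts. -/

section QuadraticForms

variable {L : Type*} [NormedAddCommGroup L] [InnerProductSpace ℝ L]
variable {ι : Type*}

/-- The quadratic form `∑ ⟪x i j (v j), v i⟫` of a finite matrix of operators. -/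
noncomputable def quadForm (s : Finset ι) (x : ι → ι → L →L[ℝ] L) (v : ι → L) : ℝ :=
  ∑ i ∈ s, ∑ j ∈ s, inner ℝ (x i j (v j)) (v i)

theorem quadForm_add (s : Finset ι) (x y : ι → ι → L →L[ℝ] L) (v : ι → L) :
    quadForm s (fun i j => x i j + y i j) v = quadForm s x v + quadForm s y v := by
  simp only [quadForm, add_apply, inner_add_left, Finset.sum_add_distrib]

theorem quadForm_sub (s : Finset ι) (x y : ι → ι → L →L[ℝ] L) (v : ι → L) :
    quadForm s (fun i j => x i j - y i j) v = quadForm s x v - quadForm s y v := by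
  simp only [quadForm, sub_apply, inner_sub_left, Finset.sum_sub_distrib]

theorem quadForm_diagonal [DecidableEq ι] (s : Finset ι) (g : L →L[ℝ] L) (v : ι → L) :
    quadForm s (fun i j => if i = j then g else 0) v = ∑ i ∈ s, inner ℝ (g (v i)) (v i) := by
  refine Finset.sum_congr rfl fun i hi => ?_
  rw [Finset.sum_eq_single_of_mem i hi]
  · simp
  · intro j _ hj; simp [hj.symm]

theorem quadForm_equivFin (s : Finset ι) (x : ι → ι → L →L[ℝ] L) (v : ι → L) :
    quadForm s x v = quadForm Finset.univ
      (fun i j => x (s.equivFin.symm i) (s.equivFin.symm j)) (fun i => v (s.equivFin.symm i)) := by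
  rw [quadForm, quadForm, ← Finset.sum_coe_sort s, ← Equiv.sum_comp s.equivFin.symm]
  refine Finset.sum_congr rfl fun i _ => ?_
  rw [← Finset.sum_coe_sort s, ← Equiv.sum_comp s.equivFin.symm]

theorem abs_quadForm_le (s : Finset ι) (x : ι → ι → L →L[ℝ] L) (v : ι → L) :
    |quadForm s x v| ≤ (∑ i ∈ s, ∑ j ∈ s, ‖x i j‖) * ∑ k ∈ s, ‖v k‖ ^ 2 := by
  rw [quadForm, Finset.sum_mul]
  refine (Finset.abs_sum_le_sum_abs _ _).trans (Finset.sum_le_sum fun i hi => ?_)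
  rw [Finset.sum_mul]
  refine (Finset.abs_sum_le_sum_abs _ _).trans (Finset.sum_le_sum fun j hj => ?_)
  have h1 : |inner ℝ (x i j (v j)) (v i)| ≤ ‖x i j‖ * (‖v j‖ * ‖v i‖) := by
    rw [← mul_assoc]
    exact (abs_real_inner_le_norm _ _).trans (by gcongr; exact ContinuousLinearMap.le_opNorm _ _)
  refine h1.trans (mul_le_mul_of_nonneg_left ?_ (norm_nonneg _))
  have hi' := Finset.single_le_sum (f := fun k => ‖v k‖ ^ 2) (fun _ _ => by positivity) hi
  have hj' := Finset.single_le_sum (f := fun k => ‖v k‖ ^ 2) (fun _ _ => by positivity) hj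
  nlinarith [sq_nonneg (‖v j‖ - ‖v i‖)]

variable [CompleteSpace L]

theorem quadForm_conj (s : Finset ι) (x : ι → ι → L →L[ℝ] L) (f : L →L[ℝ] L) (v : ι → L) :
    quadForm s (fun i j => star f * x i j * f) v = quadForm s x (fun i => f (v i)) := by
  refine Finset.sum_congr rfl fun i _ => Finset.sum_congr rfl fun j _ => ?_
  rw [mul_apply_eq_comp, mul_apply_eq_comp,
    ContinuousLinearMap.star_eq_adjoint, ContinuousLinearMap.adjoint_inner_left]

theorem isRealPositive_iff (a : L →L[ℝ] L) :
    IsRealPositive a ↔ ∀ v, 0 ≤ inner ℝ (a v) v := by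
  rw [IsRealPositive, ContinuousLinearMap.isPositive_iff]
  have key : ∀ v, inner ℝ ((a + star a) v) v = 2 * inner ℝ (a v) v := by
    intro v
    rw [add_apply, inner_add_left, ContinuousLinearMap.star_eq_adjoint,
      ContinuousLinearMap.adjoint_inner_left, real_inner_comm (a v) v]
    ring
  constructor
  · intro h v
    have := h.2 v
    rw [key] at this
    linarith
  · intro h
    refine ⟨fun v w => ?_, fun v => ?_⟩
    · simp only [ContinuousLinearMap.coe_coe, add_apply, inner_add_left,
        inner_add_right, ContinuousLinearMap.star_eq_adjoint,
        ContinuousLinearMap.adjoint_inner_left, ContinuousLinearMap.adjoint_inner_right]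
      ring
    · rw [key]; linarith [h v]

omit [CompleteSpace L] in
theorem inner_matOp {n : ℕ} (x : Matrix (Fin n) (Fin n) (L →L[ℝ] L))
    (v w : PiLp 2 (fun _ : Fin n => L)) :
    inner ℝ (matOp x v) w = ∑ i, ∑ j, inner ℝ (x i j (v j)) (w i) := by
  rw [PiLp.inner_apply]
  refine Finset.sum_congr rfl fun i _ => ?_
  rw [matOp_apply, sum_inner]

theorem isRealPositive_matOp_iff {n : ℕ} (x : Matrix (Fin n) (Fin n) (L →L[ℝ] L)) :
    IsRealPositive (matOp x) ↔ ∀ v : Fin n → L, 0 ≤ quadForm Finset.univ x v := by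
  rw [isRealPositive_iff]
  constructor
  · intro h v
    have := h (WithLp.toLp 2 v)
    rwa [inner_matOp] at this
  · intro h v
    rw [inner_matOp]
    exact h v

variable {H : Type*} [NormedAddCommGroup H] [InnerProductSpace ℝ H] [CompleteSpace H]

theorem IsRCP.quadForm_nonneg {A : Submodule ℝ (L →L[ℝ] L)} {T : A →ₗ[ℝ] (H →L[ℝ] H)}
    (hT : IsRCP T) (s : Finset ι) (x : ι → ι → A)
    (hx : ∀ v : ι → L, 0 ≤ quadForm s (fun i j => (x i j : L →L[ℝ] L)) v) (w : ι → H) :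
    0 ≤ quadForm s (fun i j => T (x i j)) w := by
  classical
  have h1 := hT s.card (Matrix.of fun i j => x (s.equivFin.symm i) (s.equivFin.symm j)) (by
    rw [matSub, isRealPositive_matOp_iff]
    intro v
    -- The value $0$ off $s$ is arbitrary, since the form only sums over $s$.
    have h2 := hx (fun i => if h : i ∈ s then v (s.equivFin ⟨i, h⟩) else 0)
    rw [quadForm_equivFin] at h2
    simp only [Equiv.apply_symm_apply, Finset.coe_mem, dite_true, Subtype.coe_eta] at h2
    exact h2)
  rw [matAmp, isRealPositive_matOp_iff] at h1
  rw [quadForm_equivFin]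
  exact h1 _

/-- Evaluating the form at $f v$ amounts to replacing $x_{ij}$ by $f^*x_{ij}f$, and
$f^*x_{ij}f\approx fx_{ij}f\approx x_{ij}$. -/
theorem HasAlmostSelfAdjointUnits.exists_compression {A : Submodule ℝ (L →L[ℝ] L)}
    (hA : HasAlmostSelfAdjointUnits A) (s : Finset ι) (x : ι → ι → L →L[ℝ] L)
    (hx : ∀ i j, x i j ∈ A) {δ : ℝ} (hδ : 0 < δ) :
    ∃ f ∈ A, f * f ∈ A ∧ ‖f‖ ≤ 1 ∧ ‖f - star f‖ ≤ δ ∧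
      ∀ v, |quadForm s x v - quadForm s x (fun i => f (v i))| ≤ δ * ∑ i ∈ s, ‖v i‖ ^ 2 := by
  classical
  set D : ℝ := ∑ i ∈ s, ∑ j ∈ s, (1 + ‖x i j‖) with hD
  have hD0 : 0 ≤ D := by positivity
  have hδ' : 0 < δ / (D + 1) := by positivity
  obtain ⟨f, hfA, hffA, hf1, hfs, hfx⟩ := hA ((s ×ˢ s).image fun p => x p.1 p.2) (by
    intro a ha
    obtain ⟨p, -, rfl⟩ := Finset.mem_image.1 ha
    exact hx _ _) _ hδ'
  refine ⟨f, hfA, hffA, hf1, hfs.trans (div_le_self hδ.le (by linarith)), fun v => ?_⟩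
  rw [← quadForm_conj, ← quadForm_sub]
  refine (abs_quadForm_le _ _ _).trans (mul_le_mul_of_nonneg_right ?_ (by positivity))
  have h1 : ∀ i ∈ s, ∀ j ∈ s, ‖x i j - star f * x i j * f‖ ≤ (1 + ‖x i j‖) * (δ / (D + 1)) := by
    intro i hi j hj
    have e1 : x i j - star f * x i j * f =
        (f - star f) * x i j * f - (f * x i j * f - x i j) := by noncomm_ring
    have e2 : ‖(f - star f) * x i j * f‖ ≤ δ / (D + 1) * ‖x i j‖ := by
      calc ‖(f - star f) * x i j * f‖ ≤ ‖(f - star f) * x i j‖ * ‖f‖ := norm_mul_le _ _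
        _ ≤ ‖(f - star f) * x i j‖ := mul_le_of_le_one_right (norm_nonneg _) hf1
        _ ≤ ‖f - star f‖ * ‖x i j‖ := norm_mul_le _ _
        _ ≤ _ := by gcongr
    have e3 := hfx (x i j) (Finset.mem_image.2 ⟨(i, j), Finset.mk_mem_product hi hj, rfl⟩)
    rw [e1]
    have := norm_sub_le ((f - star f) * x i j * f) (f * x i j * f - x i j)
    linarith
  calc ∑ i ∈ s, ∑ j ∈ s, ‖x i j - star f * x i j * f‖
      ≤ ∑ i ∈ s, ∑ j ∈ s, (1 + ‖x i j‖) * (δ / (D + 1)) :=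
        Finset.sum_le_sum fun i hi => Finset.sum_le_sum fun j hj => h1 i hi j hj
    _ = D * (δ / (D + 1)) := by simp only [hD, Finset.sum_mul]
    _ ≤ δ := by
      rw [mul_div_assoc', div_le_iff₀ (by positivity)]
      nlinarith

theorem abs_inner_mul_self_sub_le {f : L →L[ℝ] L} (hf : ‖f‖ ≤ 1) {δ : ℝ}
    (hδ : ‖f - star f‖ ≤ δ) (v w : L) :
    |inner ℝ ((f * f) v) w - inner ℝ (f v) (f w)| ≤ δ * (‖v‖ * ‖w‖) := by
  have e1 : inner ℝ (f v) (f w) = inner ℝ (star f (f v)) w := by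
    rw [ContinuousLinearMap.star_eq_adjoint, ContinuousLinearMap.adjoint_inner_left]
  rw [e1, ← inner_sub_left]
  have e2 : (f * f) v - star f (f v) = ((f - star f) * f) v := rfl
  rw [e2]
  calc |inner ℝ (((f - star f) * f) v) w| ≤ ‖((f - star f) * f) v‖ * ‖w‖ :=
        abs_real_inner_le_norm _ _
    _ ≤ (‖(f - star f) * f‖ * ‖v‖) * ‖w‖ := by
        gcongr; exact ContinuousLinearMap.le_opNorm _ _
    _ ≤ (δ * ‖v‖) * ‖w‖ := by
        gcongr
        exact (norm_mul_le _ _).trans ((mul_le_of_le_one_right (norm_nonneg _) hf).trans hδ)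
    _ = _ := by ring

/-- The element is $\varepsilon f^2$, with $f$ almost selfadjoint: it compensates $-\varepsilon
f^*f$ up to a small error. -/
theorem HasAlmostSelfAdjointUnits.exists_halving {A : Submodule ℝ (L →L[ℝ] L)}
    (hA : HasAlmostSelfAdjointUnits A) (s : Finset ι) (y : ι → ι → L →L[ℝ] L)
    (hy : ∀ i j, y i j ∈ A) {ε : ℝ} (hε : 0 < ε)
    (h : ∀ v, -(ε * ∑ i ∈ s, ‖v i‖ ^ 2) ≤ quadForm s y v) :
    ∃ g ∈ A, ‖g‖ ≤ ε ∧ ∀ v, -(ε / 2 * ∑ i ∈ s, ‖v i‖ ^ 2) ≤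
      quadForm s y v + ∑ i ∈ s, inner ℝ (g (v i)) (v i) := by
  -- The compression costs $\delta$ and replacing $f^*f$ by $f^2$ costs $\varepsilon\delta$;
  -- together $\delta(1+\varepsilon)=\varepsilon/2$.
  have hδ : 0 < ε / (2 * (1 + ε)) := by positivity
  obtain ⟨f, -, hff, hf1, hfs, hfy⟩ := hA.exists_compression s y hy hδ
  have hδε : ε / (2 * (1 + ε)) * (1 + ε) = ε / 2 := by field_simp
  set δ := ε / (2 * (1 + ε))
  refine ⟨ε • (f * f), A.smul_mem _ hff, ?_, fun v => ?_⟩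
  · rw [norm_smul, Real.norm_of_nonneg hε.le]
    exact mul_le_of_le_one_right hε.le ((norm_mul_le _ _).trans
      (mul_le_one₀ hf1 (norm_nonneg _) hf1))
  · have h1 := (abs_le.1 (hfy v)).1
    have h2 := h fun i => f (v i)
    have h3 : ∑ i ∈ s, ‖f (v i)‖ ^ 2 ≤
        ∑ i ∈ s, inner ℝ ((f * f) (v i)) (v i) + δ * ∑ i ∈ s, ‖v i‖ ^ 2 := by
      rw [Finset.mul_sum, ← Finset.sum_add_distrib]
      refine Finset.sum_le_sum fun i _ => ?_
      have := (abs_le.1 (abs_inner_mul_self_sub_le hf1 hfs (v i) (v i))).1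
      rw [real_inner_self_eq_norm_sq, ← pow_two] at this
      linarith
    have h4 : ∑ i ∈ s, inner ℝ ((ε • (f * f)) (v i)) (v i) =
        ε * ∑ i ∈ s, inner ℝ ((f * f) (v i)) (v i) := by
      rw [Finset.mul_sum]
      refine Finset.sum_congr rfl fun i _ => ?_
      rw [smul_apply, real_inner_smul_left]
    rw [h4, ← hδε]
    have h5 := mul_le_mul_of_nonneg_left h3 hε.le
    linarith

/-- Halving repeatedly gives corrections of norm at most
$\varepsilon,\varepsilon/2,\varepsilon/4,\dots$, which sum to at most $2\varepsilon$; the limit lies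
in $A$ because $A$ is closed. -/
theorem HasAlmostSelfAdjointUnits.exists_absorbing {A : Submodule ℝ (L →L[ℝ] L)}
    (hA : HasAlmostSelfAdjointUnits A) (hcl : IsClosed (A : Set (L →L[ℝ] L))) (s : Finset ι)
    (y : ι → ι → L →L[ℝ] L) (hy : ∀ i j, y i j ∈ A) {ε : ℝ} (hε : 0 < ε)
    (h : ∀ v, -(ε * ∑ i ∈ s, ‖v i‖ ^ 2) ≤ quadForm s y v) :
    ∃ g ∈ A, ‖g‖ ≤ 2 * ε ∧ ∀ v, 0 ≤ quadForm s y v + ∑ i ∈ s, inner ℝ (g (v i)) (v i) := by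
  classical
  let P : ℕ → (L →L[ℝ] L) → Prop := fun k G => G ∈ A ∧
    ∀ v, -(ε / 2 ^ k * ∑ i ∈ s, ‖v i‖ ^ 2) ≤ quadForm s y v + ∑ i ∈ s, inner ℝ (G (v i)) (v i)
  have step : ∀ k (G : {G // P k G}), ∃ G' : {G // P (k + 1) G},
      ‖(G : L →L[ℝ] L) - G'‖ ≤ ε / 2 ^ k := by
    rintro k ⟨G, hGA, hG⟩
    obtain ⟨g, hgA, hg, hgv⟩ := hA.exists_halving s
      (fun i j => y i j + if i = j then G else 0)
      (fun i j => A.add_mem (hy i j) (by split_ifs; exacts [hGA, A.zero_mem]))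
      (ε := ε / 2 ^ k) (by positivity) (fun v => by
        rw [quadForm_add, quadForm_diagonal]; exact hG v)
    refine ⟨⟨G + g, A.add_mem hGA hgA, fun v => ?_⟩, by simpa using hg⟩
    have := hgv v
    rw [quadForm_add, quadForm_diagonal] at this
    simp only [add_apply, inner_add_left, Finset.sum_add_distrib]
    rw [pow_succ, ← div_div]
    linarith
  choose next hnext using step
  have h0 : P 0 0 := ⟨A.zero_mem, fun v => by simpa using h v⟩
  let G : (k : ℕ) → {G // P k G} := fun k => Nat.rec ⟨0, h0⟩ (fun k G => next k G) k
  have hd : ∀ k, dist (G k).1 (G (k + 1)).1 ≤ 2 * ε / 2 / 2 ^ k := by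
    intro k
    rw [dist_eq_norm, mul_div_cancel_left₀ _ two_ne_zero]
    exact hnext k (G k)
  obtain ⟨g, hg⟩ := cauchySeq_tendsto_of_complete (cauchySeq_of_le_geometric_two hd)
  refine ⟨g, hcl.mem_of_tendsto hg (Eventually.of_forall fun k => (G k).2.1), ?_, fun v => ?_⟩
  · have := dist_le_of_le_geometric_two_of_tendsto₀ hd hg
    rwa [show (G 0).1 = 0 from rfl, dist_zero_left] at this
  · have t1 : Tendsto (fun k : ℕ => -(ε / 2 ^ k * ∑ i ∈ s, ‖v i‖ ^ 2)) atTop (𝓝 0) := by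
      have : Tendsto (fun k : ℕ => (2 : ℝ)⁻¹ ^ k) atTop (𝓝 0) :=
        tendsto_pow_atTop_nhds_zero_of_lt_one (by norm_num) (by norm_num)
      have := ((this.const_mul ε).mul_const (∑ i ∈ s, ‖v i‖ ^ 2)).neg
      simpa [div_eq_mul_inv] using this
    have t2 : Tendsto (fun k => quadForm s y v +
        ∑ i ∈ s, inner ℝ ((G k).1 (v i)) (v i)) atTop
        (𝓝 (quadForm s y v + ∑ i ∈ s, inner ℝ (g (v i)) (v i))) := by
      refine tendsto_const_nhds.add (tendsto_finsetSum _ fun i _ => ?_)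
      have : Tendsto (fun k => (G k).1 (v i)) atTop (𝓝 (g (v i))) :=
        ((ContinuousLinearMap.apply ℝ L (v i)).continuous.tendsto g).comp hg
      exact this.inner tendsto_const_nhds
    exact le_of_tendsto_of_tendsto' t1 t2 fun k => (G k).2.2 v

end QuadraticForms

/-! ### Automatic boundedness. -/

section Boundedness

theorem opNorm_le_of_two_inner_add_nonneg {E : Type*} [NormedAddCommGroup E]
    [InnerProductSpace ℝ E] {R : E →L[ℝ] E} {C : ℝ} (hC : 0 ≤ C)
    (h : ∀ v w, 0 ≤ C * ‖v‖ ^ 2 + C * ‖w‖ ^ 2 + 2 * inner ℝ (R v) w) : ‖R‖ ≤ C := by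
  refine ContinuousLinearMap.opNorm_le_bound _ hC fun v => ?_
  by_cases hR : ‖R v‖ = 0
  · rw [hR]; positivity
  have hR' : 0 < ‖R v‖ := lt_of_le_of_ne (norm_nonneg _) (Ne.symm hR)
  have hv : 0 < ‖v‖ := norm_pos_iff.2 fun h0 => hR (by rw [h0, map_zero, norm_zero])
  -- This vector has the norm of $v$ and points opposite to $Rv$, the worst case.
  have h1 := h v (-(‖v‖ / ‖R v‖) • R v)
  rw [norm_smul, norm_neg, Real.norm_of_nonneg (by positivity), div_mul_cancel₀ _ hR,
    real_inner_smul_right, real_inner_self_eq_norm_sq] at h1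
  have h2 : -(‖v‖ / ‖R v‖) * ‖R v‖ ^ 2 = -(‖v‖ * ‖R v‖) := by field_simp
  rw [h2] at h1
  have h3 : ‖v‖ * ‖R v‖ ≤ ‖v‖ * (C * ‖v‖) := by nlinarith
  exact le_of_mul_le_mul_left h3 hv

variable {L : Type*} [NormedAddCommGroup L] [InnerProductSpace ℝ L] [CompleteSpace L]
variable {H : Type*} [NormedAddCommGroup H] [InnerProductSpace ℝ H] [CompleteSpace H]
variable {A : Submodule ℝ (L →L[ℝ] L)} {T : A →ₗ[ℝ] (H →L[ℝ] H)}

theorem IsRCP.inner_nonneg (hT : IsRCP T) (g : A)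
    (hg : ∀ v, 0 ≤ inner ℝ ((g : L →L[ℝ] L) v) v) (h : H) : 0 ≤ inner ℝ (T g h) h := by
  have := hT.quadForm_nonneg (Finset.univ : Finset Unit) (fun _ _ => g)
    (fun v => by simpa [quadForm] using hg (v ())) (fun _ => h)
  simpa [quadForm] using this

/-- Applies $T$ to the block matrix with $g$ on the diagonal, $2a$ below and $0$ above. Real
positivity sees only the symmetric part, so $a^*$, possibly outside $A$, is not needed. -/
theorem IsRCP.two_by_two (hT : IsRCP T) {ι : Type*} [Fintype ι] (a : ι → ι → A) (g : A)
    (hag : ∀ v w : ι → L, 0 ≤ ∑ i, inner ℝ ((g : L →L[ℝ] L) (v i)) (v i) +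
      ∑ i, inner ℝ ((g : L →L[ℝ] L) (w i)) (w i) +
      2 * ∑ i, ∑ j, inner ℝ ((a i j : L →L[ℝ] L) (v j)) (w i)) (h k : ι → H) :
    0 ≤ ∑ i, inner ℝ (T g (h i)) (h i) + ∑ i, inner ℝ (T g (k i)) (k i) +
      2 * ∑ i, ∑ j, inner ℝ (T (a i j) (h j)) (k i) := by
  classical
  let x : ι ⊕ ι → ι ⊕ ι → A := fun p q => match p, q with
    | .inl i, .inl j => if i = j then g else 0
    | .inl _, .inr _ => 0
    | .inr i, .inl j => (2 : ℝ) • a i j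
    | .inr i, .inr j => if i = j then g else 0
  have key := hT.quadForm_nonneg Finset.univ x (fun v => by
    have h1 := hag (fun i => v (.inl i)) (fun i => v (.inr i))
    have e1 := quadForm_diagonal Finset.univ (g : L →L[ℝ] L) (fun i => v (.inl i))
    have e2 := quadForm_diagonal Finset.univ (g : L →L[ℝ] L) (fun i => v (.inr i))
    rw [← e1, ← e2] at h1
    simp only [quadForm, Fintype.sum_sum_type, x, apply_ite Subtype.val, ZeroMemClass.coe_zero,
      zero_apply, inner_zero_left, Finset.sum_const_zero, SetLike.val_smul, smul_apply,
      real_inner_smul_left, Finset.sum_add_distrib, ← Finset.mul_sum] at h1 ⊢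
    linarith) (Sum.elim h k)
  have e1 := quadForm_diagonal Finset.univ (T g) h
  have e2 := quadForm_diagonal Finset.univ (T g) k
  rw [← e1, ← e2]
  simp only [quadForm, Fintype.sum_sum_type, x, apply_ite T, map_zero, Sum.elim_inl, Sum.elim_inr,
      zero_apply, inner_zero_left, Finset.sum_const_zero, map_smul, smul_apply,
      real_inner_smul_left, Finset.sum_add_distrib, ← Finset.mul_sum] at key ⊢
  linarith

theorem IsRCP.two_by_two_single (hT : IsRCP T) (a g : A)
    (hag : ∀ v w : L, 0 ≤ inner ℝ ((g : L →L[ℝ] L) v) v + inner ℝ ((g : L →L[ℝ] L) w) w +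
      2 * inner ℝ ((a : L →L[ℝ] L) v) w) (h k : H) :
    0 ≤ inner ℝ (T g h) h + inner ℝ (T g k) k + 2 * inner ℝ (T a h) k := by
  have := hT.two_by_two (ι := Unit) (fun _ _ => a) g
    (fun v w => by simpa using hag (v ()) (w ())) (fun _ => h) (fun _ => k)
  simpa using this

/-- `e` is a selfadjoint identity for the operators in `A`. -/
structure IsSelfAdjointUnit (A : Submodule ℝ (L →L[ℝ] L)) (e : L →L[ℝ] L) : Prop where
  mem : e ∈ A
  star_eq : star e = e
  mul_eq : ∀ a ∈ A, e * a = a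
  eq_mul : ∀ a ∈ A, a * e = a

namespace IsSelfAdjointUnit

variable {e : L →L[ℝ] L} (he : IsSelfAdjointUnit A e)
include he

theorem inner_eq (v : L) : inner ℝ (e v) v = ‖e v‖ ^ 2 := by
  rw [← real_inner_self_eq_norm_sq]
  conv_rhs => rw [← ContinuousLinearMap.adjoint_inner_left, ← ContinuousLinearMap.star_eq_adjoint,
    he.star_eq, ← mul_apply_eq_comp, he.mul_eq e he.mem]

theorem norm_le_one : ‖e‖ ≤ 1 := by
  have h := CStarRing.norm_star_mul_self (x := e)
  rw [he.star_eq, he.mul_eq e he.mem] at h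
  by_contra! h1
  nlinarith

theorem inner_apply_apply {a : L →L[ℝ] L} (ha : a ∈ A) (v w : L) :
    inner ℝ (a (e v)) (e w) = inner ℝ (a v) w := by
  conv_lhs => rw [← ContinuousLinearMap.adjoint_inner_left, ← ContinuousLinearMap.star_eq_adjoint,
    he.star_eq, ← mul_apply_eq_comp, ← mul_apply_eq_comp, he.mul_eq a ha, he.eq_mul a ha]

theorem hasAlmostSelfAdjointUnits : HasAlmostSelfAdjointUnits A := by
  intro F hF δ hδ
  refine ⟨e, he.mem, by rw [he.mul_eq e he.mem]; exact he.mem, he.norm_le_one, ?_, fun a ha => ?_⟩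
  · rw [he.star_eq, sub_self, norm_zero]; exact hδ.le
  · rw [he.mul_eq a (hF a ha), he.eq_mul a (hF a ha), sub_self, norm_zero]; exact hδ.le

theorem exists_absorbing {ι : Type*} (s : Finset ι)
    (y : ι → ι → L →L[ℝ] L) (hy : ∀ i j, y i j ∈ A) {ε : ℝ} (hε : 0 < ε)
    (h : ∀ v, -(ε * ∑ i ∈ s, ‖v i‖ ^ 2) ≤ quadForm s y v) :
    ∃ g ∈ A, ‖g‖ ≤ 2 * ε ∧ ∀ v, 0 ≤ quadForm s y v + ∑ i ∈ s, inner ℝ (g (v i)) (v i) := by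
  refine ⟨ε • e, A.smul_mem _ he.mem, ?_, fun v => ?_⟩
  · rw [norm_smul, Real.norm_of_nonneg hε.le]
    nlinarith [he.norm_le_one]
  · have h1 := h fun i => e (v i)
    have h2 : quadForm s y (fun i => e (v i)) = quadForm s y v :=
      Finset.sum_congr rfl fun i _ => Finset.sum_congr rfl fun j _ =>
        he.inner_apply_apply (hy i j) _ _
    have h3 : ∑ i ∈ s, inner ℝ ((ε • e) (v i)) (v i) = ε * ∑ i ∈ s, ‖e (v i)‖ ^ 2 := by
      rw [Finset.mul_sum]
      refine Finset.sum_congr rfl fun i _ => ?_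
      rw [smul_apply, real_inner_smul_left, he.inner_eq]
    rw [h2] at h1
    rw [h3]
    linarith

/-- As $a=eae$ and $e$ is a projection, a contraction $a$ satisfies $|\langle
av,w\rangle|\le\|ev\|\|ew\|$, so the block matrix with $e$ on the diagonal is real positive. -/
theorem norm_map_le (hT : IsRCP T) {a : A} (ha : ‖a‖ ≤ 1) : ‖T a‖ ≤ ‖T ⟨e, he.mem⟩‖ := by
  have bd : ∀ h : H, inner ℝ (T ⟨e, he.mem⟩ h) h ≤ ‖T ⟨e, he.mem⟩‖ * ‖h‖ ^ 2 := by
    intro h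
    calc inner ℝ (T ⟨e, he.mem⟩ h) h ≤ ‖T ⟨e, he.mem⟩ h‖ * ‖h‖ := real_inner_le_norm _ _
      _ ≤ (‖T ⟨e, he.mem⟩‖ * ‖h‖) * ‖h‖ := by gcongr; exact ContinuousLinearMap.le_opNorm _ _
      _ = _ := by ring
  refine opNorm_le_of_two_inner_add_nonneg (norm_nonneg _) fun h k => ?_
  have := hT.two_by_two_single a ⟨e, he.mem⟩ (fun v w => by
    simp only
    rw [he.inner_eq, he.inner_eq, ← he.inner_apply_apply a.2 v w]
    have h1 : |inner ℝ ((a : L →L[ℝ] L) (e v)) (e w)| ≤ ‖e v‖ * ‖e w‖ := by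
      refine (abs_real_inner_le_norm _ _).trans ?_
      gcongr
      exact (ContinuousLinearMap.le_opNorm _ _).trans (mul_le_of_le_one_left (norm_nonneg _) ha)
    nlinarith [(abs_le.1 h1).1, sq_nonneg (‖e v‖ - ‖e w‖)]) h k
  linarith [bd h, bd k]

end IsSelfAdjointUnit

/-- A gliding hump: if $T(g_k)$ has form exceeding $4^k$, then $G=\sum2^{-k}g_k$ lies in the closed
space $A$ and dominates each $2^{-k}g_k$, forcing $\|T(G)\|\ge2^k$ for all $k$. -/
theorem IsRCP.exists_bound_of_realPositive (hT : IsRCP T)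
    (hcl : IsClosed (A : Set (L →L[ℝ] L))) :
    ∃ C : ℝ, 0 ≤ C ∧ ∀ g : A, ‖g‖ ≤ 2 → (∀ v, 0 ≤ inner ℝ ((g : L →L[ℝ] L) v) v) →
      ∀ h : H, inner ℝ (T g h) h ≤ C * ‖h‖ ^ 2 := by
  by_contra! hcon
  choose g hg2 hgp h hgh using fun k : ℕ => hcon (4 ^ k) (by positivity)
  have hs : Summable fun k => (1 / 2 : ℝ) ^ k • (g k : L →L[ℝ] L) := by
    refine Summable.of_norm_bounded (g := fun k => (1 / 2 : ℝ) ^ k * 2)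
      (summable_geometric_two.mul_right 2) fun k => ?_
    rw [norm_smul, norm_pow, Real.norm_of_nonneg (by norm_num)]
    gcongr
    exact hg2 k
  obtain ⟨G, hG⟩ := hs
  have hGA : G ∈ A := hcl.mem_of_tendsto hG (Eventually.of_forall fun F =>
    A.sum_mem fun k _ => A.smul_mem _ (g k).2)
  have hle : ∀ k v, 0 ≤ inner ℝ ((G - (1 / 2 : ℝ) ^ k • (g k : L →L[ℝ] L)) v) v := by
    intro k v
    have h1 : HasSum (fun k => inner ℝ (((1 / 2 : ℝ) ^ k • (g k : L →L[ℝ] L)) v) v)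
        (inner ℝ (G v) v) := by
      have h2 := hG.mapL (ContinuousLinearMap.apply ℝ L v)
      have h3 := h2.mapL (innerSL ℝ v)
      simpa [real_inner_comm v, real_inner_smul_right] using h3
    have h2 := le_hasSum h1 k fun j _ => by
      rw [smul_apply, real_inner_smul_left]
      exact mul_nonneg (by positivity) (hgp j v)
    rw [sub_apply, inner_sub_left]
    linarith
  obtain ⟨k, hk⟩ := pow_unbounded_of_one_lt ‖T ⟨G, hGA⟩‖ (one_lt_two : (1 : ℝ) < 2)
  have h1 := hT.inner_nonneg (⟨G, hGA⟩ - (1 / 2 : ℝ) ^ k • g k) (hle k) (h k)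
  rw [map_sub, map_smul, sub_apply, inner_sub_left, smul_apply, real_inner_smul_left] at h1
  have h2 : inner ℝ (T ⟨G, hGA⟩ (h k)) (h k) ≤ 2 ^ k * ‖h k‖ ^ 2 := by
    calc inner ℝ (T ⟨G, hGA⟩ (h k)) (h k) ≤ ‖T ⟨G, hGA⟩ (h k)‖ * ‖h k‖ := real_inner_le_norm _ _
      _ ≤ (‖T ⟨G, hGA⟩‖ * ‖h k‖) * ‖h k‖ := by gcongr; exact ContinuousLinearMap.le_opNorm _ _
      _ ≤ (2 ^ k * ‖h k‖) * ‖h k‖ := by gcongr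
      _ = _ := by ring
  have h3 := mul_lt_mul_of_pos_left (hgh k) (show (0 : ℝ) < (1 / 2) ^ k by positivity)
  have h4 : (1 / 2 : ℝ) ^ k * (4 ^ k * ‖h k‖ ^ 2) = 2 ^ k * ‖h k‖ ^ 2 := by
    rw [← mul_assoc, ← mul_pow]; norm_num
  linarith

/-- For a contraction $a$ the block matrix with single entry $2a$ is bounded below by $-1$.
Absorption yields a real positive diagonal $g$ with $\|g\|\le2$, on which $T$ is already controlled.
-/
theorem IsRCP.exists_bound (hT : IsRCP T) (hA : HasAlmostSelfAdjointUnits A)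
    (hcl : IsClosed (A : Set (L →L[ℝ] L))) :
    ∃ C : ℝ, 0 ≤ C ∧ ∀ a : A, ‖a‖ ≤ 1 → ‖T a‖ ≤ C := by
  obtain ⟨C, hC, hb⟩ := hT.exists_bound_of_realPositive hcl
  refine ⟨C, hC, fun a ha => ?_⟩
  obtain ⟨g, hgA, hg, hgv⟩ := hA.exists_absorbing hcl (Finset.univ : Finset Bool)
    (fun i j => if i = true ∧ j = false then (2 : ℝ) • (a : L →L[ℝ] L) else 0)
    (fun i j => by split_ifs; exacts [A.smul_mem _ a.2, A.zero_mem]) one_pos (fun v => by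
      have h1 : |inner ℝ ((a : L →L[ℝ] L) (v false)) (v true)| ≤ ‖v false‖ * ‖v true‖ := by
        refine (abs_real_inner_le_norm _ _).trans ?_
        gcongr
        exact (ContinuousLinearMap.le_opNorm _ _).trans (mul_le_of_le_one_left (norm_nonneg _) ha)
      simp only [quadForm, Fintype.sum_bool, and_true, and_false, if_true, if_false, smul_apply,
        real_inner_smul_left, zero_apply, inner_zero_left, reduceCtorEq]
      nlinarith [(abs_le.1 h1).1, sq_nonneg (‖v false‖ - ‖v true‖)])
  have hag : ∀ v w : L, 0 ≤ inner ℝ (g v) v + inner ℝ (g w) w +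
      2 * inner ℝ ((a : L →L[ℝ] L) v) w := by
    intro v w
    have := hgv fun b => if b then w else v
    simp only [quadForm, Fintype.sum_bool, and_true, and_false, if_true, if_false, smul_apply,
        real_inner_smul_left, zero_apply, inner_zero_left, reduceCtorEq, Bool.false_eq_true] at this
    linarith
  have hgp : ∀ v, 0 ≤ inner ℝ (g v) v := fun v => by simpa using hag v 0
  refine opNorm_le_of_two_inner_add_nonneg hC fun h k => ?_
  have hb' := hb ⟨g, hgA⟩ (by simpa using hg) hgp
  linarith [hb' h, hb' k, hT.two_by_two_single a ⟨g, hgA⟩ hag h k]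

end Boundedness

/-! ### Matrices as tensors, and positivity after adding scalar matrices. -/

section Extension

variable {L : Type*} [NormedAddCommGroup L] [InnerProductSpace ℝ L] [CompleteSpace L]
variable {H : Type*} [NormedAddCommGroup H] [InnerProductSpace ℝ H] [CompleteSpace H]
variable {A : Submodule ℝ (L →L[ℝ] L)} {T : A →ₗ[ℝ] (H →L[ℝ] H)}
variable {ι : Type*}

/-- Almost positive finite matrices over `A` can be made positive by adding a small element of `A`
to the diagonal. -/
def HasAbsorption (ι : Type*) (A : Submodule ℝ (L →L[ℝ] L)) : Prop :=
  ∀ (s : Finset ι) (y : ι → ι → L →L[ℝ] L), (∀ i j, y i j ∈ A) → ∀ ε > 0,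
    (∀ v, -(ε * ∑ i ∈ s, ‖v i‖ ^ 2) ≤ quadForm s y v) →
    ∃ g ∈ A, ‖g‖ ≤ 2 * ε ∧ ∀ v, 0 ≤ quadForm s y v + ∑ i ∈ s, inner ℝ (g (v i)) (v i)

/-- Behaves as if $T$ sent $1$ to $M$: replace $1$ by $f^2\in A$ with $f$ almost selfadjoint, absorb
the error into $A$, apply $T$, and bound $T(f^2)$ by $M$. The hypothesis on $m$ says that it pairs
nonnegatively, at $w$, with every real positive operator. -/
theorem IsRCP.quadForm_add_scalar_nonneg (hT : IsRCP T) (hA : HasAlmostSelfAdjointUnits A)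
    (hAbs : HasAbsorption ι A) {M : ℝ} (hM : 0 ≤ M) (hTM : ∀ a : A, ‖T a‖ ≤ M * ‖a‖)
    (s : Finset ι) (a : ι → ι → A) (m : ι → ι → ℝ) (w : ι → H)
    (hpos : ∀ v : ι → L, 0 ≤ quadForm s (fun i j => (a i j : L →L[ℝ] L)) v +
      quadForm s (fun i j => m i j • (1 : L →L[ℝ] L)) v)
    (hm : ∀ R : H →L[ℝ] H, (∀ h, 0 ≤ inner ℝ (R h) h) →
      0 ≤ quadForm s (fun i j => m i j • R) w) :
    0 ≤ quadForm s (fun i j => T (a i j)) w +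
      M * quadForm s (fun i j => m i j • (1 : H →L[ℝ] H)) w := by
  classical
  set D : ℝ := ∑ i ∈ s, ∑ j ∈ s, |m i j| with hD
  have hD0 : 0 ≤ D := by positivity
  set W : ℝ := ∑ i ∈ s, ‖w i‖ ^ 2 with hW
  have hW0 : 0 ≤ W := by positivity
  refine le_of_forall_pos_le_add fun η hη => ?_
  have hδ : 0 < η / (2 * M * (1 + D) * W + 1) := by positivity
  have hδη : 2 * M * (1 + D) * W * (η / (2 * M * (1 + D) * W + 1)) ≤ η := by
    rw [mul_div_assoc', div_le_iff₀ (by positivity)]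
    nlinarith
  set δ := η / (2 * M * (1 + D) * W + 1)
  obtain ⟨f, -, hff, hf1, hfs, hfa⟩ := hA.exists_compression s (fun i j => (a i j : L →L[ℝ] L))
    (fun i j => (a i j).2) hδ
  have hcomp : ∀ v, -(δ * (1 + D) * ∑ i ∈ s, ‖v i‖ ^ 2) ≤
      quadForm s (fun i j => (a i j : L →L[ℝ] L) + m i j • (f * f)) v := by
    intro v
    have h1 := (abs_le.1 (hfa v)).1
    have h2 := hpos fun i => f (v i)
    have h3 := quadForm_conj s (fun i j => m i j • (1 : L →L[ℝ] L)) f v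
    have h4 := abs_quadForm_le s
      (fun i j => m i j • (f * f) - star f * (m i j • (1 : L →L[ℝ] L)) * f) v
    rw [quadForm_sub, h3] at h4
    have h5 : ∑ i ∈ s, ∑ j ∈ s, ‖m i j • (f * f) - star f * (m i j • (1 : L →L[ℝ] L)) * f‖ ≤
        D * δ := by
      simp only [hD, Finset.sum_mul]
      refine Finset.sum_le_sum fun i _ => Finset.sum_le_sum fun j _ => ?_
      have e1 : m i j • (f * f) - star f * (m i j • (1 : L →L[ℝ] L)) * f =
          m i j • ((f - star f) * f) := by
        rw [mul_smul_comm, smul_mul_assoc, ← smul_sub, mul_one, sub_mul]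
      rw [e1, norm_smul, Real.norm_eq_abs]
      gcongr
      exact (norm_mul_le _ _).trans ((mul_le_of_le_one_right (norm_nonneg _) hf1).trans hfs)
    have h6 := mul_le_mul_of_nonneg_right h5
      (show 0 ≤ ∑ i ∈ s, ‖v i‖ ^ 2 from Finset.sum_nonneg fun _ _ => by positivity)
    have h7 := (abs_le.1 (h4.trans h6)).1
    rw [quadForm_add]
    linarith
  obtain ⟨g, hgA, hg, hgv⟩ := hAbs s _ (fun i j => A.add_mem (a i j).2 (A.smul_mem _ hff))
    (δ * (1 + D)) (by positivity) hcomp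
  have key := hT.quadForm_nonneg s
    (fun i j => a i j + m i j • ⟨f * f, hff⟩ + if i = j then ⟨g, hgA⟩ else 0) (fun v => by
      have := hgv v
      rw [← quadForm_diagonal, ← quadForm_add] at this
      simpa [apply_ite Subtype.val] using this) w
  simp only [map_add, map_smul, apply_ite T, map_zero] at key
  rw [quadForm_add, quadForm_add, quadForm_diagonal] at key
  have bd : ∀ (c : A) (h : H), inner ℝ (T c h) h ≤ M * ‖c‖ * ‖h‖ ^ 2 := by
    intro c h
    calc inner ℝ (T c h) h ≤ ‖T c h‖ * ‖h‖ := real_inner_le_norm _ _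
      _ ≤ (M * ‖c‖ * ‖h‖) * ‖h‖ := by
          gcongr
          exact (ContinuousLinearMap.le_opNorm _ _).trans (by gcongr; exact hTM c)
      _ = _ := by ring
  -- This operator is real positive because $\|f^2\|\le1$; it trades $T(f^2)$ for $M$.
  have h1 := hm (M • (1 : H →L[ℝ] H) - T ⟨f * f, hff⟩) fun h => by
    rw [sub_apply, inner_sub_left, smul_apply, real_inner_smul_left, one_apply_eq_self,
      real_inner_self_eq_norm_sq]
    have h2 := bd ⟨f * f, hff⟩ h
    have h3 : ‖(⟨f * f, hff⟩ : A)‖ ≤ 1 :=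
      (norm_mul_le _ _).trans (mul_le_one₀ hf1 (norm_nonneg _) hf1)
    have h4 : M * ‖(⟨f * f, hff⟩ : A)‖ * ‖h‖ ^ 2 ≤ M * 1 * ‖h‖ ^ 2 := by gcongr
    linarith
  have h2 : quadForm s (fun i j => m i j • (M • (1 : H →L[ℝ] H) - T ⟨f * f, hff⟩)) w =
      M * quadForm s (fun i j => m i j • (1 : H →L[ℝ] H)) w -
        quadForm s (fun i j => m i j • T ⟨f * f, hff⟩) w := by
    simp only [smul_sub]
    rw [quadForm_sub]
    congr 1
    simp only [quadForm, Finset.mul_sum, smul_apply, real_inner_smul_left]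
    exact Finset.sum_congr rfl fun i _ => Finset.sum_congr rfl fun j _ => by ring
  rw [h2] at h1
  have h3 : ∑ i ∈ s, inner ℝ (T ⟨g, hgA⟩ (w i)) (w i) ≤ M * (2 * (δ * (1 + D))) * W := by
    rw [hW, Finset.mul_sum]
    refine Finset.sum_le_sum fun i _ => (bd _ _).trans ?_
    gcongr
    exact hg
  linarith

/-- The functional `x ↦ ∑ ⟪R (x (i, j)) (v j), v i⟫` on finitely supported matrices over `X`. -/
noncomputable def matrixFunctional {X : Type*} [AddCommGroup X] [Module ℝ X]
    (R : X →ₗ[ℝ] (L →L[ℝ] L)) (v : ι → L) : (ι × ι →₀ X) →ₗ[ℝ] ℝ :=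
  Finsupp.lsum ℝ fun p =>
    { toFun := fun x => inner ℝ (R x (v p.2)) (v p.1)
      map_add' := fun x y => by rw [map_add, add_apply, inner_add_left]
      map_smul' := fun c x => by
        rw [map_smul, smul_apply, real_inner_smul_left, RingHom.id_apply, smul_eq_mul] }

omit [CompleteSpace L] in
theorem matrixFunctional_single {X : Type*} [AddCommGroup X] [Module ℝ X]
    (R : X →ₗ[ℝ] (L →L[ℝ] L)) (v : ι → L) (p : ι × ι) (x : X) :
    matrixFunctional R v (Finsupp.single p x) = inner ℝ (R x (v p.2)) (v p.1) := by
  simp [matrixFunctional]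

omit [CompleteSpace L] in
theorem matrixFunctional_eq_quadForm {X : Type*} [AddCommGroup X] [Module ℝ X]
    (R : X →ₗ[ℝ] (L →L[ℝ] L)) (v : ι → L) (x : ι × ι →₀ X) {s : Finset ι}
    (hs : x.support ⊆ s ×ˢ s) :
    matrixFunctional R v x = quadForm s (fun i j => R (x (i, j))) v := by
  rw [matrixFunctional, Finsupp.lsum_apply, Finsupp.sum_of_support_subset _ hs _ (by simp),
    Finset.sum_product]
  rfl

theorem exists_support_subset_product [DecidableEq ι] {X : Type*} [AddCommGroup X]
    (x : ι × ι →₀ X) : ∃ s : Finset ι, x.support ⊆ s ×ˢ s :=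
  ⟨x.support.image Prod.fst ∪ x.support.image Prod.snd, fun _ hp => Finset.mem_product.2
    ⟨Finset.mem_union_left _ (Finset.mem_image_of_mem _ hp),
      Finset.mem_union_right _ (Finset.mem_image_of_mem _ hp)⟩⟩

/-- The matrix of the elementary tensor `h ⊗ k ⊗ x` in the basis `b`. -/
noncomputable def rankOneMatrix (b : Module.Basis ι ℝ H) (X : Type*) [AddCommGroup X] [Module ℝ X] :
    H →ₗ[ℝ] H →ₗ[ℝ] X →ₗ[ℝ] (ι × ι →₀ X) :=
  b.constr ℝ fun j => b.constr ℝ fun i => Finsupp.lsingle (i, j)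

omit [CompleteSpace H] in
theorem basis_induction (b : Module.Basis ι ℝ H) {P : H → Prop} (basis : ∀ i, P (b i))
    (zero : P 0) (add : ∀ x y, P x → P y → P (x + y)) (smul : ∀ (c : ℝ) x, P x → P (c • x))
    (h : H) : P h :=
  Submodule.span_induction (p := fun x _ => P x) (by rintro _ ⟨i, rfl⟩; exact basis i) zero
    (fun x y _ _ => add x y) (fun c x _ => smul c x) (b.mem_span h)

omit [CompleteSpace H] in
theorem rankOneMatrix_basis (b : Module.Basis ι ℝ H) {X : Type*} [AddCommGroup X] [Module ℝ X]
    (i j : ι) (x : X) : rankOneMatrix b X (b j) (b i) x = Finsupp.single (i, j) x := by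
  simp [rankOneMatrix]

omit [CompleteSpace H] in
theorem mapRange_rankOneMatrix (b : Module.Basis ι ℝ H) {X Y : Type*} [AddCommGroup X]
    [Module ℝ X] [AddCommGroup Y] [Module ℝ Y] (f : X →ₗ[ℝ] Y) (h k : H) (x : X) :
    Finsupp.mapRange.linearMap f (rankOneMatrix b X h k x) = rankOneMatrix b Y h k (f x) := by
  induction h using basis_induction b with
  | basis j =>
    induction k using basis_induction b with
    | basis i => simp [rankOneMatrix_basis]
    | zero => simp
    | add k k' hk hk' => simp only [map_add, LinearMap.add_apply, hk, hk']
    | smul c k hk => simp only [map_smul, LinearMap.smul_apply, hk]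
  | zero => simp
  | add k k' hk hk' => simp only [map_add, LinearMap.add_apply, hk, hk']
  | smul c k hk => simp only [map_smul, LinearMap.smul_apply, hk]

-- Families $v:\iota\to L$ correspond to linear maps $H\to L$, so the form of a matrix can be
-- evaluated without coordinates.
omit [CompleteSpace L] [CompleteSpace H] in
theorem matrixFunctional_rankOneMatrix (b : Module.Basis ι ℝ H) {X : Type*} [AddCommGroup X]
    [Module ℝ X] (R : X →ₗ[ℝ] (L →L[ℝ] L)) (v : ι → L) (h k : H) (x : X) :
    matrixFunctional R v (rankOneMatrix b X h k x) =
      inner ℝ (R x (b.constr ℝ v h)) (b.constr ℝ v k) := by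
  induction h using basis_induction b with
  | basis j =>
    induction k using basis_induction b with
    | basis i => simp [rankOneMatrix_basis, matrixFunctional_single]
    | zero => simp
    | add k k' hk hk' => simp only [map_add, LinearMap.add_apply, hk, hk', inner_add_right]
    | smul c k hk =>
      simp only [map_smul, LinearMap.smul_apply, hk, real_inner_smul_right, smul_eq_mul]
  | zero => simp
  | add k k' hk hk' => simp only [map_add, LinearMap.add_apply, hk, hk', inner_add_left]
  | smul c k hk =>
    simp only [map_smul, LinearMap.smul_apply, hk, real_inner_smul_left, smul_eq_mul]

theorem exists_operator_of_bilinear {G : H →ₗ[ℝ] H →ₗ[ℝ] ℝ} {C : ℝ}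
    (h : ∀ v w, 0 ≤ C * ‖v‖ ^ 2 + C * ‖w‖ ^ 2 + 2 * G v w) :
    ∃ R : H →L[ℝ] H, ∀ v w, inner ℝ (R v) w = G v w := by
  have h1 : ∀ v w, -(C * ‖v‖ * ‖w‖) ≤ G v w := by
    intro v w
    by_cases hv : v = 0
    · simp [hv]
    by_cases hw : w = 0
    · simp [hw]
    have hv' : 0 < ‖v‖ := norm_pos_iff.2 hv
    have hw' : 0 < ‖w‖ := norm_pos_iff.2 hw
    have h2 := h (‖v‖⁻¹ • v) (‖w‖⁻¹ • w)
    rw [norm_smul, norm_smul, norm_inv, norm_inv, norm_norm, norm_norm, inv_mul_cancel₀ hv'.ne',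
      inv_mul_cancel₀ hw'.ne'] at h2
    simp only [map_smul, LinearMap.smul_apply, smul_eq_mul] at h2
    have h3 : 0 ≤ (2 * (‖v‖ * ‖w‖)) * (C + ‖v‖⁻¹ * (‖w‖⁻¹ * G v w)) :=
      mul_nonneg (by positivity) (by linarith)
    have h4 : (2 * (‖v‖ * ‖w‖)) * (C + ‖v‖⁻¹ * (‖w‖⁻¹ * G v w)) =
        2 * (C * ‖v‖ * ‖w‖ + G v w) := by field_simp
    linarith
  have h2 : ∀ v w, ‖G v w‖ ≤ C * ‖v‖ * ‖w‖ := by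
    intro v w
    rw [Real.norm_eq_abs, abs_le]
    refine ⟨h1 v w, ?_⟩
    -- The hypothesis is one-sided; the sign change gives the other bound.
    have := h1 v (-w)
    rw [map_neg, norm_neg] at this
    linarith
  refine ⟨InnerProductSpace.continuousLinearMapOfBilin (𝕜 := ℝ) (G.mkContinuous₂ C h2), fun v w => ?_⟩
  rw [InnerProductSpace.continuousLinearMapOfBilin_apply]
  rfl

end Extension

/-! ### The extension to $B(L)$ by the M. Riesz theorem. -/

section Extension

variable {L : Type*} [NormedAddCommGroup L] [InnerProductSpace ℝ L] [CompleteSpace L]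
variable {H : Type*} [NormedAddCommGroup H] [InnerProductSpace ℝ H] [CompleteSpace H]
variable {A : Submodule ℝ (L →L[ℝ] L)} {T : A →ₗ[ℝ] (H →L[ℝ] H)}
variable {ι : Type*}

omit [CompleteSpace L] in
theorem matrixFunctional_mapRange {X Y : Type*} [AddCommGroup X] [Module ℝ X] [AddCommGroup Y]
    [Module ℝ Y] (R : Y →ₗ[ℝ] (L →L[ℝ] L)) (f : X →ₗ[ℝ] Y) (v : ι → L) (x : ι × ι →₀ X) :
    matrixFunctional R v (Finsupp.mapRange.linearMap f x) = matrixFunctional (R ∘ₗ f) v x := by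
  induction x using Finsupp.induction_linear with
  | zero => simp
  | add x y hx hy => rw [map_add, map_add, map_add, hx, hy]
  | single p x => simp [matrixFunctional_single]

/-- The inclusion of scalar matrices into matrices over `B(L)`. -/
noncomputable def scalarMatrix (ι : Type*) (L : Type*) [NormedAddCommGroup L]
    [InnerProductSpace ℝ L] : (ι × ι →₀ ℝ) →ₗ[ℝ] (ι × ι →₀ (L →L[ℝ] L)) :=
  Finsupp.mapRange.linearMap (LinearMap.toSpanSingleton ℝ (L →L[ℝ] L) 1)

omit [CompleteSpace L] in
theorem matrixFunctional_scalarMatrix (v : ι → L) (m : ι × ι →₀ ℝ) :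
    matrixFunctional LinearMap.id v (scalarMatrix ι L m) =
      matrixFunctional (LinearMap.toSpanSingleton ℝ (L →L[ℝ] L) 1) v m := by
  rw [scalarMatrix, matrixFunctional_mapRange]
  rfl

/-- The cone of pairs `(x, t)` such that `x + m ⊗ 1` is real positive for some scalar matrix
`m ≥ 0` of weight at most `t`. -/
def dominationCone (b : Module.Basis ι ℝ H) (L : Type*) [NormedAddCommGroup L]
    [InnerProductSpace ℝ L] (M : ℝ) : PointedCone ℝ ((ι × ι →₀ (L →L[ℝ] L)) × ℝ) where
  carrier := {z | ∃ m : ι × ι →₀ ℝ,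
    (∀ R : H →L[ℝ] H, (∀ h, 0 ≤ inner ℝ (R h) h) →
      0 ≤ matrixFunctional (LinearMap.toSpanSingleton ℝ (H →L[ℝ] H) R) b m) ∧
    (∀ v : ι → L, 0 ≤ matrixFunctional LinearMap.id v (z.1 + scalarMatrix ι L m)) ∧
    M * matrixFunctional (LinearMap.toSpanSingleton ℝ (H →L[ℝ] H) 1) b m ≤ z.2}
  zero_mem' := ⟨0, by simp, by simp, by simp⟩
  add_mem' := by
    rintro z z' ⟨m, h1, h2, h3⟩ ⟨m', h1', h2', h3'⟩
    refine ⟨m + m', fun R hR => ?_, fun v => ?_, ?_⟩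
    · rw [map_add]; exact add_nonneg (h1 R hR) (h1' R hR)
    · have := add_nonneg (h2 v) (h2' v)
      rwa [← map_add, add_add_add_comm, ← map_add] at this
    · rw [map_add, mul_add]; exact add_le_add h3 h3'
  smul_mem' := by
    rintro ⟨c, hc⟩ z ⟨m, h1, h2, h3⟩
    refine ⟨c • m, fun R hR => ?_, fun v => ?_, ?_⟩
    · rw [map_smul]; exact mul_nonneg hc (h1 R hR)
    · have := mul_nonneg hc (h2 v)
      rw [← smul_eq_mul, ← map_smul, smul_add, ← map_smul] at this
      exact this
    · rw [map_smul, smul_eq_mul, mul_left_comm]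
      exact mul_le_mul_of_nonneg_left h3 hc

omit [CompleteSpace L] [CompleteSpace H] in
theorem mem_dominationCone_of_nonneg (b : Module.Basis ι ℝ H) (M : ℝ)
    {x : ι × ι →₀ (L →L[ℝ] L)} (hx : ∀ v : ι → L, 0 ≤ matrixFunctional LinearMap.id v x) :
    (x, (0 : ℝ)) ∈ dominationCone b L M :=
  ⟨0, by simp, by simpa using hx, by simp⟩

-- Taking $m=h\otimes h$ cancels the matrix exactly; this membership gives the bound on $\Phi(1)$.
omit [CompleteSpace L] [CompleteSpace H] in
theorem neg_rankOneMatrix_mem_dominationCone (b : Module.Basis ι ℝ H) (M : ℝ) (h : H) :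
    (-rankOneMatrix b (L →L[ℝ] L) h h 1, M * ‖h‖ ^ 2) ∈ dominationCone b L M := by
  refine ⟨rankOneMatrix b ℝ h h 1, fun R hR => ?_, fun v => ?_, ?_⟩
  · rw [matrixFunctional_rankOneMatrix]
    simpa using hR (b.constr ℝ b h)
  · rw [scalarMatrix, mapRange_rankOneMatrix]
    simp
  · rw [matrixFunctional_rankOneMatrix]
    have : b.constr ℝ b h = h := by
      have : b.constr ℝ b = LinearMap.id := b.ext fun i => by simp
      rw [this]; rfl
    simp [this]

-- A large multiple of a finite diagonal dominates any finitely supported matrix; this is the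
-- cofinality hypothesis of the Riesz theorem.
omit [CompleteSpace L] [CompleteSpace H] in
theorem exists_mem_dominationCone (b : Module.Basis ι ℝ H) (M : ℝ)
    (x : ι × ι →₀ (L →L[ℝ] L)) : ∃ t : ℝ, (x, t) ∈ dominationCone b L M := by
  classical
  obtain ⟨s, hs⟩ := exists_support_subset_product x
  set r : ℝ := ∑ i ∈ s, ∑ j ∈ s, ‖x (i, j)‖ with hr
  have hr0 : 0 ≤ r := by positivity
  refine ⟨_, ∑ i ∈ s, Finsupp.single (i, i) r, fun R hR => ?_, fun v => ?_, le_rfl⟩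
  · rw [map_sum]
    refine Finset.sum_nonneg fun i _ => ?_
    rw [matrixFunctional_single]
    simpa [real_inner_smul_left] using mul_nonneg hr0 (hR (b i))
  · rw [map_add, matrixFunctional_scalarMatrix, map_sum, matrixFunctional_eq_quadForm _ _ _ hs]
    have h1 := (abs_le.1 (abs_quadForm_le s (fun i j => x (i, j)) v)).1
    rw [← hr, Finset.mul_sum] at h1
    simpa [matrixFunctional_single, real_inner_smul_left] using neg_le_iff_add_nonneg.1 h1

theorem exists_functional_extension (b : Module.Basis ι ℝ H) (hT : IsRCP T)
    (hA : HasAlmostSelfAdjointUnits A) (hAbs : HasAbsorption ι A) {M : ℝ} (hM : 0 ≤ M)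
    (hTM : ∀ a : A, ‖T a‖ ≤ M * ‖a‖) :
    ∃ g : (ι × ι →₀ (L →L[ℝ] L)) →ₗ[ℝ] ℝ,
      (∀ (a : A) (h k : H), g (rankOneMatrix b _ h k (a : L →L[ℝ] L)) = inner ℝ (T a h) k) ∧
      (∀ x, (∀ v : ι → L, 0 ≤ matrixFunctional LinearMap.id v x) → 0 ≤ g x) ∧
      ∀ h, g (rankOneMatrix b _ h h 1) ≤ M * ‖h‖ ^ 2 := by
  classical
  let J : ((ι × ι →₀ A) × ℝ) →ₗ[ℝ] ((ι × ι →₀ (L →L[ℝ] L)) × ℝ) :=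
    (Finsupp.mapRange.linearMap A.subtype).prodMap LinearMap.id
  have hJ : Function.Injective J := Function.Injective.prodMap
    (Finsupp.mapRange_injective _ (map_zero _) A.subtype_injective) Function.injective_id
  let F : ((ι × ι →₀ A) × ℝ) →ₗ[ℝ] ℝ := LinearMap.coprod (matrixFunctional T b) LinearMap.id
  let f : ((ι × ι →₀ (L →L[ℝ] L)) × ℝ) →ₗ.[ℝ] ℝ :=
    ⟨LinearMap.range J, F ∘ₗ (LinearEquiv.ofInjective J hJ).symm.toLinearMap⟩
  have hfJ : ∀ z, f ⟨J z, LinearMap.mem_range_self J z⟩ = F z := by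
    intro z
    change F ((LinearEquiv.ofInjective J hJ).symm _) = F z
    congr 1
    rw [LinearEquiv.symm_apply_eq]
    rfl
  obtain ⟨G, hG, hGC⟩ := riesz_extension (dominationCone b L M) f (by
    rintro ⟨_, ⟨a, t⟩, rfl⟩ hz
    rw [hfJ]
    obtain ⟨m, h1, h2, h3⟩ := hz
    change M * _ ≤ t at h3
    obtain ⟨s₁, hs₁⟩ := exists_support_subset_product a
    obtain ⟨s₂, hs₂⟩ := exists_support_subset_product m
    have hs₁' : a.support ⊆ (s₁ ∪ s₂) ×ˢ (s₁ ∪ s₂) := hs₁.trans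
      (Finset.product_subset_product Finset.subset_union_left Finset.subset_union_left)
    have hs₂' : m.support ⊆ (s₁ ∪ s₂) ×ˢ (s₁ ∪ s₂) := hs₂.trans
      (Finset.product_subset_product Finset.subset_union_right Finset.subset_union_right)
    have key := hT.quadForm_add_scalar_nonneg hA hAbs hM hTM (s₁ ∪ s₂) (fun i j => a (i, j))
      (fun i j => m (i, j)) b (fun v => by
        have h4 : 0 ≤ matrixFunctional LinearMap.id v
          (Finsupp.mapRange.linearMap A.subtype a + scalarMatrix ι L m) := h2 v
        rw [map_add, matrixFunctional_scalarMatrix, matrixFunctional_eq_quadForm _ _ m hs₂',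
          matrixFunctional_mapRange, matrixFunctional_eq_quadForm _ _ a hs₁'] at h4
        exact h4) (fun R hR => by
        have h4 := h1 R hR
        rw [matrixFunctional_eq_quadForm _ _ m hs₂'] at h4
        exact h4)
    rw [matrixFunctional_eq_quadForm _ _ m hs₂'] at h3
    change 0 ≤ matrixFunctional T b a + t
    rw [matrixFunctional_eq_quadForm _ _ a hs₁']
    exact key.trans (by gcongr; exact h3)) (by
    rintro ⟨x, t⟩
    -- Only the real coordinate, which lies in the domain of $f$, has to be shifted.
    obtain ⟨t', ht'⟩ := exists_mem_dominationCone b M x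
    refine ⟨⟨J (0, t' - t), LinearMap.mem_range_self J _⟩, ?_⟩
    have : J (0, t' - t) + (x, t) = (x, t') := by simp [J]
    rw [this]
    exact ht')
  have hG1 : G (0, 1) = 1 := by
    have h1 := hG ⟨J (0, 1), LinearMap.mem_range_self J _⟩
    rw [hfJ] at h1
    simpa [J, F] using h1
  have hGt : ∀ t : ℝ, G (0, t) = t := by
    intro t
    have : ((0, t) : (ι × ι →₀ (L →L[ℝ] L)) × ℝ) = t • (0, 1) := by simp
    rw [this, map_smul, hG1, smul_eq_mul, mul_one]
  refine ⟨G ∘ₗ LinearMap.inl ℝ _ _, fun a h k => ?_, fun x hx => ?_, fun h => ?_⟩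
  · have h1 := hG ⟨J (rankOneMatrix b A h k a, 0), LinearMap.mem_range_self J _⟩
    rw [hfJ] at h1
    have h2 : J (rankOneMatrix b A h k a, 0) = (rankOneMatrix b _ h k (a : L →L[ℝ] L), 0) := by
      simp only [J, LinearMap.prodMap_apply, mapRange_rankOneMatrix]
      rfl
    have h3 : F (rankOneMatrix b A h k a, 0) = inner ℝ (T a h) k := by
      have h4 : b.constr ℝ b = LinearMap.id := b.ext fun i => by simp
      simp [F, matrixFunctional_rankOneMatrix, h4]
    simp only [h2, h3] at h1
    exact h1
  · exact hGC _ (mem_dominationCone_of_nonneg b M hx)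
  · have h1 := hGC _ (neg_rankOneMatrix_mem_dominationCone (L := L) b M h)
    have h2 : ((-rankOneMatrix b (L →L[ℝ] L) h h 1, M * ‖h‖ ^ 2) :
        (ι × ι →₀ (L →L[ℝ] L)) × ℝ) =
        (0, M * ‖h‖ ^ 2) - LinearMap.inl ℝ _ ℝ (rankOneMatrix b (L →L[ℝ] L) h h 1) := by simp
    rw [h2, map_sub, hGt] at h1
    exact sub_nonneg.1 h1

/-- Extension of a real completely positive map to all operators. -/
theorem IsRCP.exists_extension (hT : IsRCP T)
    (hA : HasAlmostSelfAdjointUnits A) (b : Module.Basis ι ℝ H) (hAbs : HasAbsorption ι A) {M : ℝ}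
    (hM : 0 ≤ M) (hTM : ∀ a : A, ‖T a‖ ≤ M * ‖a‖) :
    ∃ Φ : (⊤ : Submodule ℝ (L →L[ℝ] L)) →ₗ[ℝ] (H →L[ℝ] H), IsRCP Φ ∧
      (∀ a : A, Φ ⟨a, trivial⟩ = T a) ∧
      ∀ h, inner ℝ (Φ ⟨1, trivial⟩ h) h ≤ M * ‖h‖ ^ 2 := by
  obtain ⟨g, hgT, hgpos, hg1⟩ := exists_functional_extension b hT hA hAbs hM hTM
  have bil : ∀ x : L →L[ℝ] L, ∃ R : H →L[ℝ] H, ∀ h k,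
      inner ℝ (R h) k = g (rankOneMatrix b _ h k x) := by
    intro x
    let G : H →ₗ[ℝ] H →ₗ[ℝ] ℝ := LinearMap.mk₂ ℝ (fun h k => g (rankOneMatrix b _ h k x))
      (by intros; simp) (by intros; simp) (by intros; simp) (by intros; simp)
    refine exists_operator_of_bilinear (G := G) (C := ‖x‖ * M) fun h k => ?_
    -- The block matrix with $\|x\|$ on the diagonal and $2x$ below it, compressed to $h$ and $k$.
    have h1 := hgpos (‖x‖ • rankOneMatrix b _ h h 1 + ‖x‖ • rankOneMatrix b _ k k 1 +
      (2 : ℝ) • rankOneMatrix b _ h k x) fun v => by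
        simp only [map_add, map_smul, matrixFunctional_rankOneMatrix, LinearMap.id_apply,
          one_apply_eq_self, real_inner_self_eq_norm_sq, smul_eq_mul]
        set p := b.constr ℝ v h
        set q := b.constr ℝ v k
        have h2 : |inner ℝ (x p) q| ≤ ‖x‖ * (‖p‖ * ‖q‖) := by
          rw [← mul_assoc]
          exact (abs_real_inner_le_norm _ _).trans
            (by gcongr; exact ContinuousLinearMap.le_opNorm _ _)
        have h3 := mul_nonneg (norm_nonneg x) (sq_nonneg (‖p‖ - ‖q‖))
        have h4 := (abs_le.1 h2).1
        nlinarith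
    simp only [map_add, map_smul, smul_eq_mul] at h1
    have h2 := mul_le_mul_of_nonneg_left (hg1 h) (norm_nonneg x)
    have h3 := mul_le_mul_of_nonneg_left (hg1 k) (norm_nonneg x)
    change 0 ≤ _ + 2 * g (rankOneMatrix b _ h k x)
    linarith
  choose Ψ hΨ using bil
  let Φ : (⊤ : Submodule ℝ (L →L[ℝ] L)) →ₗ[ℝ] (H →L[ℝ] H) :=
    { toFun := fun x => Ψ x
      map_add' := fun x y => ContinuousLinearMap.ext fun h => ext_inner_right ℝ fun k => by
        rw [add_apply, inner_add_left, hΨ, hΨ, hΨ, Submodule.coe_add, map_add, map_add]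
      map_smul' := fun c x => ContinuousLinearMap.ext fun h => ext_inner_right ℝ fun k => by
        rw [smul_apply, real_inner_smul_left, hΨ, hΨ, Submodule.coe_smul, map_smul, map_smul]
        rfl }
  refine ⟨Φ, fun n x hx => ?_, fun a => ?_, fun h => (hΨ 1 h h).le.trans (hg1 h)⟩
  · rw [matSub, isRealPositive_matOp_iff] at hx
    rw [matAmp, isRealPositive_matOp_iff]
    intro w
    have h1 := hgpos (∑ i, ∑ j, rankOneMatrix b _ (w j) (w i) (x i j : L →L[ℝ] L)) fun v => by
      simp only [map_sum, matrixFunctional_rankOneMatrix]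
      exact hx fun i => b.constr ℝ v (w i)
    simp only [map_sum, ← hΨ] at h1
    exact h1
  · exact ContinuousLinearMap.ext fun h => ext_inner_right ℝ fun k => by
      rw [← hgT]; exact hΨ _ _ _

end Extension

/-! ### Stinespring dilation on $B(L)$. -/

section Stinespring

universe w

theorem exists_hilbert_of_form {F : Type w} [AddCommGroup F] [Module ℝ F] (Q : F →ₗ[ℝ] F →ₗ[ℝ] ℝ)
    (symm : ∀ x y, Q x y = Q y x) (nonneg : ∀ x, 0 ≤ Q x x) :
    ∃ (K : Type w) (_ : NormedAddCommGroup K) (_ : InnerProductSpace ℝ K) (_ : CompleteSpace K)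
      (j : F →ₗ[ℝ] K), DenseRange j ∧ ∀ x y, inner ℝ (j x) (j y) = Q x y := by
  let c : PreInnerProductSpace.Core ℝ F :=
    { inner := fun x y => Q x y
      conj_inner_symm := fun x y => symm y x
      re_inner_nonneg := nonneg
      add_left := fun x y z => by simp
      smul_left := fun x y r => by simp }
  let : SeminormedAddCommGroup F := @InnerProductSpace.Core.toSeminormedAddCommGroup ℝ F _ _ _ c
  let : InnerProductSpace ℝ F := InnerProductSpace.ofCore c
  exact ⟨UniformSpace.Completion F, inferInstance, inferInstance, inferInstance,
    (UniformSpace.Completion.toComplL (𝕜 := ℝ) (E := F)).toLinearMap,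
    UniformSpace.Completion.denseRange_coe, fun x y => UniformSpace.Completion.inner_coe x y⟩

variable {L : Type*} [NormedAddCommGroup L] [InnerProductSpace ℝ L] [CompleteSpace L]
variable {H : Type*} [NormedAddCommGroup H] [InnerProductSpace ℝ H] [CompleteSpace H]
variable {Φ : (⊤ : Submodule ℝ (L →L[ℝ] L)) →ₗ[ℝ] (H →L[ℝ] H)}
variable {ι : Type*}

/-- The matrix with off-diagonal entries $x$ and $-x^*$ is skew, so its form vanishes; hence its
image has nonnegative form, and replacing $k$ by $-k$ gives equality. -/
theorem IsRCP.inner_map_star (hΦ : IsRCP Φ) (x : L →L[ℝ] L) (h k : H) :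
    inner ℝ (Φ ⟨star x, trivial⟩ h) k = inner ℝ (Φ ⟨x, trivial⟩ k) h := by
  have key : ∀ h k, 0 ≤ inner ℝ (Φ ⟨x, trivial⟩ h) k - inner ℝ (Φ ⟨star x, trivial⟩ k) h := by
    intro h k
    have := hΦ.quadForm_nonneg (Finset.univ : Finset Bool)
      (fun i j => if i = true ∧ j = false then ⟨x, trivial⟩
        else if i = false ∧ j = true then -⟨star x, trivial⟩ else 0) (fun v => by
          simp only [quadForm, Fintype.sum_bool]
          simp [ContinuousLinearMap.star_eq_adjoint, ContinuousLinearMap.adjoint_inner_left,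
            real_inner_comm (v true)])
      (fun i => if i then k else h)
    simp only [quadForm, Fintype.sum_bool] at this
    simp only [reduceCtorEq, and_true, and_false, and_self, if_true, if_false, map_zero, zero_apply,
      inner_zero_left, map_neg, neg_apply, inner_neg_left, Bool.false_eq_true] at this
    linarith
  have h1 := key k h
  have h2 := key (-k) h
  rw [map_neg, inner_neg_left, inner_neg_right] at h2
  linarith

/-- The form `⟪a ⊗ h, c ⊗ k⟫ = ⟪Φ (c* a) h, k⟫` in the coordinates of a basis of `H`. -/
noncomputable def stinespringForm (Φ : (⊤ : Submodule ℝ (L →L[ℝ] L)) →ₗ[ℝ] (H →L[ℝ] H))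
    (b : ι → H) : (ι →₀ (L →L[ℝ] L)) →ₗ[ℝ] (ι →₀ (L →L[ℝ] L)) →ₗ[ℝ] ℝ :=
  Finsupp.lsum ℝ fun q => LinearMap.flip (Finsupp.lsum ℝ fun p =>
    LinearMap.mk₂ ℝ (fun c a : L →L[ℝ] L => inner ℝ (Φ ⟨star c * a, trivial⟩ (b q)) (b p))
      (fun c c' a => by
        rw [← inner_add_left, ← add_apply, ← map_add]
        congr 4; ext1; simp [add_mul])
      (fun r c a => by
        rw [smul_eq_mul, ← real_inner_smul_left, ← smul_apply, ← map_smul]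
        congr 4; ext1; simp)
      (fun c a a' => by
        rw [← inner_add_left, ← add_apply, ← map_add]
        congr 4; ext1; simp [mul_add])
      (fun r c a => by
        rw [smul_eq_mul, ← real_inner_smul_left, ← smul_apply, ← map_smul]
        congr 4; ext1; simp))

omit [CompleteSpace H] in
theorem stinespringForm_single (b : ι → H) (p q : ι) (a c : L →L[ℝ] L) :
    stinespringForm Φ b (Finsupp.single q a) (Finsupp.single p c) =
      inner ℝ (Φ ⟨star c * a, trivial⟩ (b q)) (b p) := by
  simp [stinespringForm]

theorem stinespringForm_symm (hΦ : IsRCP Φ) (b : ι → H) (x y : ι →₀ (L →L[ℝ] L)) :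
    stinespringForm Φ b x y = stinespringForm Φ b y x := by
  induction x using Finsupp.induction_linear with
  | zero => simp
  | add x x' hx hx' => rw [map_add, map_add, LinearMap.add_apply, hx, hx']
  | single q a =>
    induction y using Finsupp.induction_linear with
    | zero => simp
    | add y y' hy hy' => rw [map_add, map_add, LinearMap.add_apply, hy, hy']
    | single p c =>
      rw [stinespringForm_single, stinespringForm_single, ← hΦ.inner_map_star]
      simp

omit [CompleteSpace H] in
theorem stinespringForm_self_eq_quadForm (b : ι → H) (x : ι →₀ (L →L[ℝ] L)) {s : Finset ι}
    (hs : x.support ⊆ s) :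
    stinespringForm Φ b x x = quadForm s (fun p q => Φ ⟨star (x p) * x q, trivial⟩) b := by
  have e : x = ∑ p ∈ s, Finsupp.single p (x p) := by
    conv_lhs => rw [← Finsupp.sum_single x]
    exact Finsupp.sum_of_support_subset _ hs _ (by simp)
  conv_lhs => rw [e]
  simp only [map_sum, LinearMap.sum_apply, stinespringForm_single]
  rfl

theorem quadForm_star_mul (s : Finset ι) (x : ι → L →L[ℝ] L) (v : ι → L) :
    quadForm s (fun p q => star (x p) * x q) v = ‖∑ q ∈ s, x q (v q)‖ ^ 2 := by
  rw [← real_inner_self_eq_norm_sq, inner_sum]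
  simp only [sum_inner]
  refine Finset.sum_congr rfl fun p _ => Finset.sum_congr rfl fun q _ => ?_
  rw [mul_apply_eq_comp, ContinuousLinearMap.star_eq_adjoint,
    ContinuousLinearMap.adjoint_inner_left]

theorem stinespringForm_self_nonneg (hΦ : IsRCP Φ) (b : ι → H) (x : ι →₀ (L →L[ℝ] L)) :
    0 ≤ stinespringForm Φ b x x := by
  rw [stinespringForm_self_eq_quadForm b x subset_rfl]
  refine hΦ.quadForm_nonneg x.support (fun p q => ⟨star (x p) * x q, trivial⟩) (fun v => ?_) b
  rw [quadForm_star_mul]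
  positivity

/-- Left multiplication by `a` on the coordinates of `B(L) ⊗ H`. -/
noncomputable def leftMul (ι : Type*) (a : L →L[ℝ] L) :
    (ι →₀ (L →L[ℝ] L)) →ₗ[ℝ] (ι →₀ (L →L[ℝ] L)) :=
  Finsupp.mapRange.linearMap (LinearMap.mulLeft ℝ a)

omit [CompleteSpace L] in
theorem leftMul_single (a c : L →L[ℝ] L) (i : ι) :
    leftMul ι a (Finsupp.single i c) = Finsupp.single i (a * c) := by
  simp [leftMul]

/-- The matrix $[x_p^*(\|a\|^2-a^*a)x_q]$ is positive, so left multiplication is bounded and passes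
to the completion. -/
theorem stinespringForm_leftMul_le (hΦ : IsRCP Φ) (b : ι → H) (a : L →L[ℝ] L)
    (x : ι →₀ (L →L[ℝ] L)) :
    stinespringForm Φ b (leftMul ι a x) (leftMul ι a x) ≤ ‖a‖ ^ 2 * stinespringForm Φ b x x := by
  rw [stinespringForm_self_eq_quadForm b x subset_rfl, stinespringForm_self_eq_quadForm b
    (leftMul ι a x) (s := x.support) (Finsupp.support_mapRange (hf := map_zero _))]
  have h1 := hΦ.quadForm_nonneg x.support
    (fun p q => ‖a‖ ^ 2 • ⟨star (x p) * x q, trivial⟩ -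
      ⟨star (leftMul ι a x p) * leftMul ι a x q, trivial⟩) (fun v => by
    simp only [Submodule.coe_sub, Submodule.coe_smul]
    rw [quadForm_sub, quadForm_star_mul]
    have h2 : quadForm x.support (fun p q => ‖a‖ ^ 2 • (star (x p) * x q)) v =
        ‖a‖ ^ 2 * quadForm x.support (fun p q => star (x p) * x q) v := by
      simp only [quadForm, Finset.mul_sum, smul_apply, real_inner_smul_left]
    have h3 : ∑ q ∈ x.support, leftMul ι a x q (v q) = a (∑ q ∈ x.support, x q (v q)) := by
      rw [map_sum]
      exact Finset.sum_congr rfl fun q _ => rfl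
    rw [h2, quadForm_star_mul, h3, ← mul_pow, sub_nonneg]
    gcongr
    exact ContinuousLinearMap.le_opNorm _ _) b
  simp only [map_sub, map_smul] at h1
  rw [quadForm_sub] at h1
  have h2 : quadForm x.support (fun p q => ‖a‖ ^ 2 • Φ ⟨star (x p) * x q, trivial⟩) b =
      ‖a‖ ^ 2 * quadForm x.support (fun p q => Φ ⟨star (x p) * x q, trivial⟩) b := by
    simp only [quadForm, Finset.mul_sum, smul_apply, real_inner_smul_left]
  rw [h2] at h1
  linarith

omit [CompleteSpace H] in
theorem stinespringForm_leftMul_left (b : ι → H) (a : L →L[ℝ] L) (x y : ι →₀ (L →L[ℝ] L)) :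
    stinespringForm Φ b (leftMul ι a x) y = stinespringForm Φ b x (leftMul ι (star a) y) := by
  induction x using Finsupp.induction_linear with
  | zero => simp
  | add x x' hx hx' =>
    rw [map_add, map_add, map_add, LinearMap.add_apply, LinearMap.add_apply, hx, hx']
  | single q c =>
    induction y using Finsupp.induction_linear with
    | zero => simp
    | add y y' hy hy' => rw [map_add, map_add, map_add, hy, hy']
    | single p d =>
      rw [leftMul_single, leftMul_single, stinespringForm_single, stinespringForm_single]
      simp [mul_assoc]

omit [CompleteSpace L] in
theorem leftMul_mul (a c : L →L[ℝ] L) (x : ι →₀ (L →L[ℝ] L)) :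
    leftMul ι (a * c) x = leftMul ι a (leftMul ι c x) := by
  ext i : 1
  simp [leftMul]

omit [CompleteSpace L] in
theorem leftMul_add (a c : L →L[ℝ] L) (x : ι →₀ (L →L[ℝ] L)) :
    leftMul ι (a + c) x = leftMul ι a x + leftMul ι c x := by
  ext i : 1
  simp [leftMul, add_mul]

omit [CompleteSpace L] in
theorem leftMul_smul (r : ℝ) (a : L →L[ℝ] L) (x : ι →₀ (L →L[ℝ] L)) :
    leftMul ι (r • a) x = r • leftMul ι a x := by
  ext i : 1
  simp [leftMul]

omit [CompleteSpace H] in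
theorem stinespringForm_leftMul_one (b : Module.Basis ι ℝ H) (a : L →L[ℝ] L) (h k : H) :
    stinespringForm Φ b (leftMul ι a (b.constr ℝ (fun i => Finsupp.single i 1) h))
      (b.constr ℝ (fun i => Finsupp.single i 1) k) = inner ℝ (Φ ⟨a, trivial⟩ h) k := by
  induction h using basis_induction b with
  | basis q =>
    induction k using basis_induction b with
    | basis p => simp [leftMul_single, stinespringForm_single]
    | zero => simp
    | add k k' hk hk' => rw [map_add, map_add, hk, hk', inner_add_right]
    | smul c k hk => rw [map_smul, map_smul, hk, real_inner_smul_right, smul_eq_mul]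
  | zero => simp
  | add h h' hh hh' =>
    rw [map_add, map_add, map_add, LinearMap.add_apply, hh, hh', map_add, inner_add_left]
  | smul c h hh =>
    rw [map_smul, map_smul, map_smul, LinearMap.smul_apply, hh, map_smul, real_inner_smul_left,
      smul_eq_mul]

/-- Stinespring's theorem for real completely positive maps on the operators of a real Hilbert
space. -/
theorem IsRCP.exists_stinespring {L : Type u} [NormedAddCommGroup L] [InnerProductSpace ℝ L]
    [CompleteSpace L] {H : Type v} [NormedAddCommGroup H] [InnerProductSpace ℝ H] [CompleteSpace H]
    {Φ : (⊤ : Submodule ℝ (L →L[ℝ] L)) →ₗ[ℝ] (H →L[ℝ] H)} (hΦ : IsRCP Φ) :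
    ∃ (K : Type (max u v)) (_ : NormedAddCommGroup K) (_ : InnerProductSpace ℝ K)
      (_ : CompleteSpace K) (π : (L →L[ℝ] L) →⋆ₙₐ[ℝ] (K →L[ℝ] K)) (V : H →L[ℝ] K),
      (∀ x, Φ ⟨x, trivial⟩ = ContinuousLinearMap.adjoint V ∘L π x ∘L V) ∧
      ∀ h, ‖V h‖ ^ 2 = inner ℝ (Φ ⟨1, trivial⟩ h) h := by
  let b := Module.Basis.ofVectorSpace ℝ H
  obtain ⟨K, _, _, _, j, hj, hjQ⟩ := exists_hilbert_of_form (stinespringForm Φ b)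
    (stinespringForm_symm hΦ b) (stinespringForm_self_nonneg hΦ b)
  have hex : ∀ a : L →L[ℝ] L, ∃ R : K →L[ℝ] K, ∀ x, R (j x) = j (leftMul _ a x) := by
    intro a
    refine ⟨(j ∘ₗ leftMul _ a).extendOfNorm j, fun x =>
      LinearMap.extendOfNorm_eq hj ⟨‖a‖, fun y => ?_⟩ x⟩
    refine (abs_le_of_sq_le_sq' ?_ (by positivity)).2
    rw [mul_pow, LinearMap.comp_apply, ← real_inner_self_eq_norm_sq (j y),
      ← real_inner_self_eq_norm_sq (j _), hjQ, hjQ]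
    exact stinespringForm_leftMul_le hΦ b a y
  choose ρ hρ using hex
  have hext : ∀ R R' : K →L[ℝ] K, (∀ x, R (j x) = R' (j x)) → R = R' := fun R R' h =>
    ContinuousLinearMap.coeFn_injective (hj.equalizer R.continuous R'.continuous (funext h))
  let π : (L →L[ℝ] L) →⋆ₙₐ[ℝ] (K →L[ℝ] K) :=
    { toFun := ρ
      map_smul' := fun r a => hext _ _ fun x => by
        simp only [MonoidHom.id_apply, smul_apply, hρ, leftMul_smul, map_smul]
      map_zero' := hext _ _ fun x => by
        have : leftMul _ (0 : L →L[ℝ] L) x = 0 := by simpa using leftMul_smul 0 (0 : L →L[ℝ] L) x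
        rw [hρ, this, map_zero, zero_apply]
      map_add' := fun a c => hext _ _ fun x => by
        simp only [add_apply, hρ, leftMul_add, map_add]
      map_mul' := fun a c => hext _ _ fun x => by
        simp only [mul_apply_eq_comp, hρ, leftMul_mul]
      map_star' := fun a => by
        rw [ContinuousLinearMap.star_eq_adjoint (ρ a), ContinuousLinearMap.eq_adjoint_iff]
        intro x y
        refine hj.induction_on₂ (p := fun x y => inner ℝ (ρ (star a) x) y = inner ℝ x (ρ a y))
          (isClosed_eq (by fun_prop) (by fun_prop)) (fun x y => ?_) x y
        rw [hρ, hρ, hjQ, hjQ, stinespringForm_leftMul_left, star_star] }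
  let v : H →ₗ[ℝ] K := j ∘ₗ b.constr ℝ (fun i => Finsupp.single i 1)
  have hv : ∀ a h k, inner ℝ (ρ a (v h)) (v k) = inner ℝ (Φ ⟨a, trivial⟩ h) k := by
    intro a h k
    simp only [v, LinearMap.comp_apply]
    rw [hρ, hjQ, stinespringForm_leftMul_one]
  have hv1 : ∀ h, ‖v h‖ ^ 2 = inner ℝ (Φ ⟨1, trivial⟩ h) h := by
    intro h
    have h1 : ρ 1 = 1 := hext _ _ fun x => by
      rw [hρ, one_apply_eq_self]
      congr 1
      ext i : 1
      simp [leftMul]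
    rw [← hv, h1, one_apply_eq_self, real_inner_self_eq_norm_sq]
  let V : H →L[ℝ] K := v.mkContinuous √‖Φ ⟨1, trivial⟩‖ fun h => by
    refine (abs_le_of_sq_le_sq' ?_ (by positivity)).2
    rw [hv1, mul_pow, Real.sq_sqrt (norm_nonneg _), pow_two, ← mul_assoc]
    exact (real_inner_le_norm _ _).trans (by gcongr; exact ContinuousLinearMap.le_opNorm _ _)
  refine ⟨K, inferInstance, inferInstance, inferInstance, π, V, fun a => ?_, hv1⟩
  refine ContinuousLinearMap.ext fun h => ext_inner_right ℝ fun k => ?_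
  rw [ContinuousLinearMap.comp_apply, ContinuousLinearMap.adjoint_inner_left]
  exact (hv a h k).symm

end Stinespring

/-! ### Norms and matrix entries. -/

section Norms

variable {L : Type*} [NormedAddCommGroup L] [InnerProductSpace ℝ L]

theorem norm_matOp_one (a : L →L[ℝ] L) :
    ‖matOp (Matrix.of fun _ _ : Fin 1 => a)‖ = ‖a‖ := by
  have hn : ∀ v : PiLp 2 (fun _ : Fin 1 => L), ‖v‖ = ‖v 0‖ := by
    intro v
    rw [PiLp.norm_eq_of_L2, Fin.sum_univ_one, Real.sqrt_sq (norm_nonneg _)]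
  refine le_antisymm (ContinuousLinearMap.opNorm_le_bound _ (norm_nonneg _) fun v => ?_)
    (ContinuousLinearMap.opNorm_le_bound _ (ContinuousLinearMap.opNorm_nonneg _) fun v => ?_)
  · rw [hn, hn v, matOp_apply, Fin.sum_univ_one]
    exact ContinuousLinearMap.le_opNorm _ _
  · have := ContinuousLinearMap.le_opNorm (matOp (Matrix.of fun _ _ : Fin 1 => a))
      (WithLp.toLp 2 fun _ => v)
    rw [hn, hn (WithLp.toLp 2 fun _ => v), matOp_apply, Fin.sum_univ_one] at this
    exact this

theorem inner_matOp_single {n : ℕ} (x : Matrix (Fin n) (Fin n) (L →L[ℝ] L)) (i j : Fin n)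
    (v w : L) : inner ℝ (matOp x (PiLp.single 2 j v)) (PiLp.single 2 i w) =
      inner ℝ (x i j v) w := by
  rw [inner_matOp, Finset.sum_eq_single i, Finset.sum_eq_single j]
  · simp
  · intro k _ hk; simp [hk]
  · simp
  · intro k _ hk; simp [hk]
  · simp

variable [CompleteSpace L]

theorem star_entry_of_isPositive {n : ℕ} {x : Matrix (Fin n) (Fin n) (L →L[ℝ] L)}
    (hx : (matOp x).IsPositive) (i j : Fin n) : star (x i j) = x j i := by
  refine ContinuousLinearMap.ext fun v => ext_inner_right ℝ fun w => ?_
  rw [ContinuousLinearMap.star_eq_adjoint, ContinuousLinearMap.adjoint_inner_left,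
    ← inner_matOp_single x j i v w, real_inner_comm, ← inner_matOp_single x i j w v]
  have := ((ContinuousLinearMap.isPositive_iff _).1 hx).1 (PiLp.single 2 j w) (PiLp.single 2 i v)
  exact this.trans (real_inner_comm _ _)

variable {H : Type*} [NormedAddCommGroup H] [InnerProductSpace ℝ H] [CompleteSpace H]
variable {A : Submodule ℝ (L →L[ℝ] L)} {T : A →ₗ[ℝ] (H →L[ℝ] H)}

omit [CompleteSpace L] [CompleteSpace H] in
theorem mapNorm_le_mapCbNorm (T : A →ₗ[ℝ] (H →L[ℝ] H)) : mapNorm T ≤ mapCbNorm T := by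
  refine iSup₂_le fun a ha => ?_
  refine le_iSup_of_le 1 (le_iSup_of_le (Matrix.of fun _ _ => a) (le_iSup_of_le ?_ ?_))
  · exact (norm_matOp_one (a : L →L[ℝ] L)).le.trans ha
  · rw [← ofReal_norm, ← ofReal_norm]
    exact ENNReal.ofReal_le_ofReal (norm_matOp_one (T a)).ge

omit [CompleteSpace L] [CompleteSpace H] in
theorem mapCbNorm_le_of_extends {X : Submodule ℝ (L →L[ℝ] L)} {S : X →ₗ[ℝ] (H →L[ℝ] H)}
    (hAX : A ≤ X) (hST : ∀ a, S (Submodule.inclusion hAX a) = T a) : mapCbNorm T ≤ mapCbNorm S := by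
  refine iSup_le fun n => iSup₂_le fun x hx => ?_
  have h1 : matAmp S (x.map (Submodule.inclusion hAX)) = matAmp T x :=
    congrArg matOp (Matrix.ext fun i j => hST (x i j))
  rw [← h1]
  exact le_iSup_of_le n (le_iSup₂_of_le (x.map (Submodule.inclusion hAX)) hx le_rfl)

omit [CompleteSpace L] [CompleteSpace H] in
theorem norm_le_mapNorm_toReal_mul (hT : mapNorm T ≠ ∞) (a : A) :
    ‖T a‖ ≤ (mapNorm T).toReal * ‖a‖ := by
  by_cases ha : a = 0
  · simp [ha]
  have ha' : 0 < ‖a‖ := norm_pos_iff.2 ha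
  have h1 : ‖T (‖a‖⁻¹ • a)‖ₑ ≤ mapNorm T := by
    refine le_iSup₂_of_le (‖a‖⁻¹ • a) ?_ le_rfl
    change ‖‖a‖⁻¹ • (a : L →L[ℝ] L)‖ ≤ 1
    rw [norm_smul, Real.norm_of_nonneg (inv_nonneg.2 ha'.le)]
    exact (inv_mul_cancel₀ ha'.ne').le
  have h2 := ENNReal.toReal_mono hT h1
  rw [toReal_enorm, map_smul, norm_smul, Real.norm_of_nonneg (inv_nonneg.2 ha'.le),
    inv_mul_le_iff₀ ha'] at h2
  linarith

theorem IsSelfAdjointUnit.mapNorm_eq {e : L →L[ℝ] L} (he : IsSelfAdjointUnit A e) (hT : IsRCP T) :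
    mapNorm T = ‖T ⟨e, he.mem⟩‖ₑ := by
  refine le_antisymm (iSup₂_le fun a ha => ?_)
    (le_iSup₂_of_le (⟨e, he.mem⟩ : A) he.norm_le_one le_rfl)
  rw [← ofReal_norm, ← ofReal_norm]
  exact ENNReal.ofReal_le_ofReal (he.norm_map_le hT ha)

end Norms

/-! ### Identities of $A$ are selfadjoint. -/

section Units

variable {L : Type*} [NormedAddCommGroup L] [InnerProductSpace ℝ L] [CompleteSpace L]
variable {A : Submodule ℝ (L →L[ℝ] L)} {B : NonUnitalStarSubalgebra ℝ (L →L[ℝ] L)}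

theorem IsUnitalSubspace.exists_isSelfAdjointUnit (hA : IsUnitalSubspace A B) :
    ∃ e, IsSelfAdjointUnit A e := by
  obtain ⟨hAB, e, heA, he⟩ := hA
  have h1 : e * star e = star e := (he (star e) (star_mem (hAB heA))).1
  have h2 : star e = e := by
    have := congrArg star h1
    rw [star_mul, star_star] at this
    rw [← h1, this]
  exact ⟨e, heA, h2, fun a ha => (he a (hAB ha)).1, fun a ha => (he a (hAB ha)).2⟩

theorem IsSelfAdjointUnit.of_jordanProd {e₀ : L →L[ℝ] L} (h₀ : IsSelfAdjointUnit A e₀)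
    {e : L →L[ℝ] L} (he : e ∈ A) (h : ∀ a ∈ A, jordanProd e a = a) : IsSelfAdjointUnit A e := by
  have h1 := h e₀ h₀.mem
  rw [jordanProd, h₀.mul_eq e he, h₀.eq_mul e he, inv_smul_eq_iff₀ two_ne_zero, ← two_smul ℝ] at h1
  have h2 : e = e₀ := smul_right_injective _ (two_ne_zero : (2 : ℝ) ≠ 0) h1
  exact h2 ▸ h₀

/-- If $e$ is a Jordan identity then $u\circ e=u$, so the approximate unit converges to $e$ in norm.
Every limit relation then becomes an identity for $e$, and $e^*e=e$ gives selfadjointness. -/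
theorem isSelfAdjointUnit_of_tendsto {l : Filter (L →L[ℝ] L)} [l.NeBot]
    (hl : ∀ᶠ e in l, e ∈ A ∧ ‖e‖ ≤ 1)
    (hlJ : ∀ a ∈ A, Tendsto (fun e => jordanProd e a) l (𝓝 a))
    (h1 : ∀ a ∈ A, Tendsto (fun e => e * a) l (𝓝 a))
    (h2 : ∀ a ∈ A, Tendsto (fun e => a * e) l (𝓝 a))
    {e : L →L[ℝ] L} (he : e ∈ A) (h : ∀ a ∈ A, jordanProd e a = a) : IsSelfAdjointUnit A e := by
  have hlim : Tendsto id l (𝓝 e) := by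
    refine (hlJ e he).congr' ?_
    filter_upwards [hl] with u hu
    rw [jordanProd_comm, h u hu.1, id]
  have hmul : ∀ a ∈ A, e * a = a := fun a ha =>
    tendsto_nhds_unique (hlim.mul_const a) (h1 a ha)
  refine ⟨he, ?_, hmul, fun a ha => tendsto_nhds_unique (hlim.const_mul a) (h2 a ha)⟩
  have h3 : star e * e = e := tendsto_nhds_unique
    (((continuous_star.tendsto e).comp hlim).mul_const e)
    (tendsto_star_mul (hl.mono fun _ hu => hu.2) (h1 e he))
  have h4 := congrArg star h3
  rw [star_mul, star_star, h3] at h4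
  exact h4.symm

end Units

/-! ### Assembly: complete positivity, the circle of norms, and the two cases. -/

section Main

variable {L : Type u} [NormedAddCommGroup L] [InnerProductSpace ℝ L] [CompleteSpace L]
variable {H : Type v} [NormedAddCommGroup H] [InnerProductSpace ℝ H] [CompleteSpace H]

/-- Real positivity supplies the nonnegative form; symmetry of the image, which is separate over
$\mathbb R$, comes from `IsRCP.inner_map_star`. -/
theorem IsRCP.isCP_restrict {Φ : (⊤ : Submodule ℝ (L →L[ℝ] L)) →ₗ[ℝ] (H →L[ℝ] H)} (hΦ : IsRCP Φ)
    (X : Submodule ℝ (L →L[ℝ] L)) : IsCP (Φ ∘ₗ Submodule.inclusion (le_top : X ≤ ⊤)) := by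
  intro n x hx
  have hstar := fun i j => star_entry_of_isPositive hx i j
  have hpos := hΦ n (x.map (Submodule.inclusion (le_top : X ≤ ⊤)))
    ((isRealPositive_iff _).2 ((ContinuousLinearMap.isPositive_iff _).1 hx).2)
  refine (ContinuousLinearMap.isPositive_iff _).2 ⟨fun v w => ?_, (isRealPositive_iff _).1 hpos⟩
  change inner ℝ (matAmp _ x v) w = inner ℝ v (matAmp _ x w)
  rw [← real_inner_comm v, matAmp, inner_matOp, inner_matOp, Finset.sum_comm]
  refine Finset.sum_congr rfl fun i _ => Finset.sum_congr rfl fun j _ => ?_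
  have h1 := hΦ.inner_map_star (x i j : L →L[ℝ] L) (v i) (w j)
  have h2 : star (x i j : L →L[ℝ] L) = x j i := hstar i j
  simp only [h2] at h1
  exact h1

/-- The block-matrix argument at level $n$, with the identity of $B(L)$ on the diagonal. -/
theorem IsRCP.mapCbNorm_restrict_le {Φ : (⊤ : Submodule ℝ (L →L[ℝ] L)) →ₗ[ℝ] (H →L[ℝ] H)}
    (hΦ : IsRCP Φ) {C : ℝ} (hC : 0 ≤ C)
    (h1 : ∀ h, inner ℝ (Φ ⟨1, trivial⟩ h) h ≤ C * ‖h‖ ^ 2) (X : Submodule ℝ (L →L[ℝ] L)) :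
    mapCbNorm (Φ ∘ₗ Submodule.inclusion (le_top : X ≤ ⊤)) ≤ ENNReal.ofReal C := by
  refine iSup_le fun n => iSup₂_le fun x hx => ?_
  rw [← ofReal_norm]
  refine ENNReal.ofReal_le_ofReal (opNorm_le_of_two_inner_add_nonneg hC fun h k => ?_)
  have key := hΦ.two_by_two (fun i j => Submodule.inclusion (le_top : X ≤ ⊤) (x i j)) ⟨1, trivial⟩
    (fun v w => by
      have e1 := inner_matOp (x.map fun a => (a : L →L[ℝ] L)) (WithLp.toLp 2 v) (WithLp.toLp 2 w)
      have e2 := PiLp.norm_sq_eq_of_L2 _ (WithLp.toLp 2 v)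
      have e3 := PiLp.norm_sq_eq_of_L2 _ (WithLp.toLp 2 w)
      have e4 : |inner ℝ (matSub x (WithLp.toLp 2 v)) (WithLp.toLp 2 w)| ≤
          ‖WithLp.toLp 2 v‖ * ‖WithLp.toLp 2 w‖ := by
        refine (abs_real_inner_le_norm _ _).trans ?_
        gcongr
        exact (ContinuousLinearMap.le_opNorm _ _).trans (mul_le_of_le_one_left (norm_nonneg _) hx)
      simp only [one_apply_eq_self, real_inner_self_eq_norm_sq]
      change _ = ∑ i, ∑ j, inner ℝ ((x i j : L →L[ℝ] L) (v j)) (w i) at e1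
      change _ = ∑ i, ‖v i‖ ^ 2 at e2
      change _ = ∑ i, ‖w i‖ ^ 2 at e3
      rw [← e2, ← e3]
      change 0 ≤ _ + 2 * ∑ i, ∑ j, inner ℝ ((x i j : L →L[ℝ] L) (v j)) (w i)
      rw [← e1]
      change 0 ≤ _ + 2 * inner ℝ (matSub x (WithLp.toLp 2 v)) (WithLp.toLp 2 w)
      nlinarith [(abs_le.1 e4).1, sq_nonneg (‖WithLp.toLp 2 v‖ - ‖WithLp.toLp 2 w‖)]) h k
  rw [matAmp, inner_matOp, PiLp.norm_sq_eq_of_L2, PiLp.norm_sq_eq_of_L2, Finset.mul_sum,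
    Finset.mul_sum]
  have h2 := Finset.sum_le_sum fun i (_ : i ∈ Finset.univ) => h1 (h i)
  have h3 := Finset.sum_le_sum fun i (_ : i ∈ Finset.univ) => h1 (k i)
  exact key.trans (add_le_add (add_le_add h2 h3) le_rfl)

theorem IsRCP.exists_stinespring_extension {A : Submodule ℝ (L →L[ℝ] L)}
    {T : A →ₗ[ℝ] (H →L[ℝ] H)} (hT : IsRCP T) (B : NonUnitalStarSubalgebra ℝ (L →L[ℝ] L))
    (hAB : A ≤ B.toSubmodule) (hA : HasAlmostSelfAdjointUnits A)
    (hAbs : HasAbsorption (Module.Basis.ofVectorSpaceIndex ℝ H) A) (hbdd : mapNorm T ≠ ∞) :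
    ∃ (S : B.toSubmodule →ₗ[ℝ] (H →L[ℝ] H))
      (K : Type (max u v)) (_ : NormedAddCommGroup K) (_ : InnerProductSpace ℝ K)
      (_ : CompleteSpace K) (π : B →⋆ₙₐ[ℝ] (K →L[ℝ] K)) (V : H →L[ℝ] K),
      IsCP S ∧
      (∀ (a : L →L[ℝ] L) (ha : a ∈ A) (hb : a ∈ B), S ⟨a, hb⟩ = T ⟨a, ha⟩) ∧
      (∀ (b : L →L[ℝ] L) (hb : b ∈ B),
        S ⟨b, hb⟩ = ContinuousLinearMap.adjoint V ∘L π ⟨b, hb⟩ ∘L V) ∧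
      mapNorm T = mapCbNorm T ∧
      mapCbNorm T = mapCbNorm S ∧
      mapCbNorm S = ‖V‖ₑ ^ 2 := by
  obtain ⟨Φ, hΦ, hΦT, hΦ1⟩ := hT.exists_extension hA (Module.Basis.ofVectorSpace ℝ H) hAbs
    ENNReal.toReal_nonneg (norm_le_mapNorm_toReal_mul hbdd)
  obtain ⟨K, _, _, _, π, V, hπ, hV⟩ := hΦ.exists_stinespring
  set S : B.toSubmodule →ₗ[ℝ] (H →L[ℝ] H) := Φ ∘ₗ Submodule.inclusion le_top with hS
  have hVe : ‖V‖ₑ ^ 2 = ENNReal.ofReal (‖V‖ ^ 2) := by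
    rw [ENNReal.ofReal_pow (norm_nonneg _), ofReal_norm]
  have c1 : ‖V‖ₑ ^ 2 ≤ mapNorm T := by
    rw [hVe]
    refine ENNReal.ofReal_le_of_le_toReal ?_
    have h1 : ‖V‖ ≤ √(mapNorm T).toReal := by
      refine ContinuousLinearMap.opNorm_le_bound _ (Real.sqrt_nonneg _) fun h => ?_
      refine (abs_le_of_sq_le_sq' ?_ (by positivity)).2
      rw [hV, mul_pow, Real.sq_sqrt ENNReal.toReal_nonneg]
      exact hΦ1 h
    calc ‖V‖ ^ 2 ≤ √(mapNorm T).toReal ^ 2 := by gcongr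
      _ = _ := Real.sq_sqrt ENNReal.toReal_nonneg
  have c2 := mapNorm_le_mapCbNorm T
  have c3 : mapCbNorm T ≤ mapCbNorm S :=
    mapCbNorm_le_of_extends hAB fun a => hΦT a
  have c4 : mapCbNorm S ≤ ‖V‖ₑ ^ 2 := by
    rw [hVe]
    refine hΦ.mapCbNorm_restrict_le (sq_nonneg _) (fun h => ?_) _
    rw [← hV, ← mul_pow]
    gcongr
    exact ContinuousLinearMap.le_opNorm _ _
  refine ⟨S, K, inferInstance, inferInstance, inferInstance,
    π.comp (NonUnitalStarSubalgebraClass.subtype B), V, hΦ.isCP_restrict _,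
    fun a ha _ => hΦT ⟨a, ha⟩, fun b _ => hπ b, ?_, ?_, ?_⟩
  · exact le_antisymm c2 (c3.trans (c4.trans c1))
  · exact le_antisymm c3 (c4.trans (c1.trans c2))
  · exact le_antisymm c4 (c1.trans (c2.trans c3))

omit [CompleteSpace L] [CompleteSpace H] in
theorem mapNorm_ne_top_of_bound {A : Submodule ℝ (L →L[ℝ] L)} {T : A →ₗ[ℝ] (H →L[ℝ] H)} {C : ℝ}
    (h : ∀ a : A, ‖a‖ ≤ 1 → ‖T a‖ ≤ C) : mapNorm T ≠ ∞ := by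
  refine ne_top_of_le_ne_top (ENNReal.ofReal_ne_top (r := C)) (iSup₂_le fun a ha => ?_)
  rw [← ofReal_norm]
  exact ENNReal.ofReal_le_ofReal (h a ha)

end Main

theorem mainTheorem3
    {L : Type u} [NormedAddCommGroup L] [InnerProductSpace ℝ L] [CompleteSpace L]
    {H : Type v} [NormedAddCommGroup H] [InnerProductSpace ℝ H] [CompleteSpace H]
    -- `B` is a real C*-algebra: a norm-closed real *-subalgebra of `B(L)`
    (B : NonUnitalStarSubalgebra ℝ (L →L[ℝ] L)) (hB : IsClosed (B : Set (L →L[ℝ] L)))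
    (A : Submodule ℝ (L →L[ℝ] L))
    (hA : IsUnitalSubspace A B ∨ IsApproxUnitalJordanSubalgebra A B)
    (T : A →ₗ[ℝ] (H →L[ℝ] H)) (hT : IsRCP T) :
    ∃ (S : B.toSubmodule →ₗ[ℝ] (H →L[ℝ] H))
      (K : Type (max u v)) (_ : NormedAddCommGroup K) (_ : InnerProductSpace ℝ K)
      (_ : CompleteSpace K) (π : B →⋆ₙₐ[ℝ] (K →L[ℝ] K)) (V : H →L[ℝ] K),
      IsCP S ∧
      (∀ (a : L →L[ℝ] L) (ha : a ∈ A) (hb : a ∈ B), S ⟨a, hb⟩ = T ⟨a, ha⟩) ∧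
      (∀ (b : L →L[ℝ] L) (hb : b ∈ B),
        S ⟨b, hb⟩ = ContinuousLinearMap.adjoint V ∘L π ⟨b, hb⟩ ∘L V) ∧
      mapNorm T = mapCbNorm T ∧
      mapCbNorm T = mapCbNorm S ∧
      mapCbNorm S = ‖V‖ₑ ^ 2 ∧
      -- if `A` has an identity `e`, the common value is `‖T(e)‖`
      (∀ (e : L →L[ℝ] L) (he : e ∈ A), (∀ a ∈ A, jordanProd e a = a) →
        mapNorm T = ‖T ⟨e, he⟩‖ₑ) := by
  have hAB : A ≤ B.toSubmodule := hA.elim (fun h => h.1) (fun h => h.1)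
  have key : HasAlmostSelfAdjointUnits A ∧
      HasAbsorption (Module.Basis.ofVectorSpaceIndex ℝ H) A ∧ mapNorm T ≠ ∞ ∧
      ∀ e ∈ A, (∀ a ∈ A, jordanProd e a = a) → IsSelfAdjointUnit A e := by
    rcases hA with hA | ⟨-, hcl, hJ, l, hl, hlA, hlJ⟩
    · obtain ⟨e, he⟩ := hA.exists_isSelfAdjointUnit
      exact ⟨he.hasAlmostSelfAdjointUnits, fun s y hy ε hε => he.exists_absorbing s y hy hε,
        mapNorm_ne_top_of_bound fun a => he.norm_map_le hT, fun e' he' => he.of_jordanProd he'⟩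
    · have h1 := fun a ha => (tendsto_mul_of_tendsto_jordanProd hJ hlA hlJ (a := a) ha).1
      have h2 := fun a ha => (tendsto_mul_of_tendsto_jordanProd hJ hlA hlJ (a := a) ha).2
      have hU := hasAlmostSelfAdjointUnits_of_tendsto hJ hlA h1 h2
      obtain ⟨C, -, hC⟩ := hT.exists_bound hU hcl
      exact ⟨hU, fun s y hy ε hε => hU.exists_absorbing hcl s y hy hε,
        mapNorm_ne_top_of_bound hC, fun e he => isSelfAdjointUnit_of_tendsto hlA hlJ h1 h2 he⟩
  obtain ⟨hU, hAbs, hbdd, hunit⟩ := key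
  obtain ⟨S, K, i1, i2, i3, π, V, hCP, hST, hdil, n1, n2, n3⟩ :=
    hT.exists_stinespring_extension B hAB hU hAbs hbdd
  exact ⟨S, K, i1, i2, i3, π, V, hCP, hST, hdil, n1, n2, n3, fun e he h =>
    (hunit e he h).mapNorm_eq hT⟩
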